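/- Let $v$ be a $C^2$ vector field on $\mathbb R^n$ (with a scalar product and the induced norm) generating a flow $\{\chi^t\}_{t\in\mathbb R}$, put $X^t(x)=\partial\chi^t(x)/\partial x$, and let $M$ be a nonempty compact $C^1$-submanifold of dimension $m<n$ contained in a domain $D\subset\mathbb R^n$, with $\chi^t(M)=M$ for all $t\in\mathbb R$ and $\operatorname{dist}(\chi^t(x),M)\to0$ as $t\to+\infty$ for all $x\in D$. Assume that the flow is hyperbolic along $M$: for every $x\in M$ there is a direct sum decomposition $\mathbb R^n=L_x^-\oplus L_x^+\oplus L_x^0$, where $L_x^0=\mathbb R\,v(x)$ is one-dimensional; the dimensions of $L_x^\pm$ do not depend on $x\in M$; the subspaces $L_x^\pm$ depend continuously on $x\in M$; $X^t(x)L_x^\pm=L^\pm_{\chi^t(x)}$ for all $t\in\mathbb R$, $x\in M$; and there are constants $c\ge1$, $\alpha>0$ such that for all $x\in M$ $$\|X^t(x)\eta\|\le c\,e^{-\alpha t}\|\eta\|\quad(t\ge0,\ \eta\in L_x^-),\qquad \|X^t(x)\eta\|\le c\,e^{\alpha t}\|\eta\|\quad(t\le0,\ \eta\in L_x^+).$$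 Let $P_x^-$ be the projection onto $L_x^-$ along $L_x^+\oplus L_x^0$, let $w(t,y,\xi)=v(\chi^t(\xi)+y)-v(\chi^t(\xi))-v'(\chi^t(\xi))y$, and for $r>0$ let $N_r=\{(\xi,\eta):\xi\in M,\ \eta\in L_\xi^-,\ \|\eta\|<r\}$. Then there exist $r,R\in(0,1)$ such that the following hold. (i) For each $(\xi,\eta)\in N_r$ there is a unique solution $y_*(\cdot,\xi,\eta):[0,\infty)\to\mathbb R^n$ of $$\dot y=v'(\chi^t(\xi))y+w(t,y,\xi)$$ with $\|y_*(t,\xi,\eta)\|\le R e^{-\alpha t}$ for all $t\ge0$ and $P_\xi^-y_*(0,\xi,\eta)=\eta$. (ii) The mapping $y_*:[0,\infty)\times N_r\to\mathbb R^n$ is continuous, and for all $t\ge0$, $\xi\in M$ the mapping $\eta\mapsto y_*(t,\xi,\eta)$ is twice continuously differentiable on $\{\eta\in L_\xi^-:\|\eta\|<r\}$. (iii) There is a constant $C_0>0$ such that $\|y_*(t,\xi,\eta)-X^t(\xi)\eta\|\le C_0e^{-\alpha t}\|\eta\|^2$ for all $t\ge0$ and $(\xi,\eta)\in N_r$. 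-/

import Mathlib

open Set Filter Topology

noncomputable section

namespace AsymptoticPhase

variable {E : Type*} [NormedAddCommGroup E] [InnerProductSpace ℝ E] [FiniteDimensional ℝ E]

/-- The vector field `v` generates the flow `χ`: every `t ↦ χ t x` solves `ẋ = v x`. -/
def Generates (v : E → E) (χ : Flow ℝ E) : Prop :=
  ∀ (x : E) (t : ℝ), HasDerivAt (fun s : ℝ => χ s x) (v (χ t x)) t

/-- `M` is an embedded `C¹`-submanifold of dimension `m` (without boundary): near each of its
points a `C¹`-diffeomorphism between open sets straightens `M` to an `m`-dimensional linear
subspace. -/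
def IsC1Submanifold (m : ℕ) (M : Set E) : Prop :=
  ∀ p ∈ M, ∃ (e : OpenPartialHomeomorph E E) (W : Submodule ℝ E),
    p ∈ e.source ∧ ContDiffOn ℝ 1 e e.source ∧ ContDiffOn ℝ 1 e.symm e.target ∧
    Module.finrank ℝ W = m ∧ e '' (M ∩ e.source) = (W : Set E) ∩ e.target

/-- `M` is a nonempty compact invariant `C¹`-submanifold of dimension `m < dim E`, contained in
the domain `D` (a connected open set) and attracting every point of `D`. -/
structure IsAttractingManifold (χ : Flow ℝ E) (m : ℕ) (M D : Set E) : Prop where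
  isOpen_domain : IsOpen D
  isConnected_domain : IsConnected D
  subset_domain : M ⊆ D
  nonempty : M.Nonempty
  isCompact : IsCompact M
  dim_lt : m < Module.finrank ℝ E
  isC1Submanifold : IsC1Submanifold m M
  invariant : ∀ t : ℝ, (fun x => χ t x) '' M = M
  attracting : ∀ x ∈ D, Tendsto (fun t : ℝ => Metric.infDist (χ t x) M) atTop (𝓝 0)

/-- `X^t(x) = ∂χ^t(x)/∂x`. -/
def X (χ : Flow ℝ E) (t : ℝ) (x : E) : E →L[ℝ] E :=
  fderiv ℝ (fun z => χ t z) x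

/-- The flow `χ` generated by `v` is hyperbolic along `M`, with stable planes `Lm x`, unstable
planes `Lp x`, neutral lines `ℝ ∙ v x` and constants `c ≥ 1`, `α > 0`. Continuity of a field of
planes is continuity into the Grassmannian, i.e. of the field of orthogonal projections. -/
structure IsHyperbolicAlong (v : E → E) (χ : Flow ℝ E) (M : Set E) (Lm Lp : E → Submodule ℝ E)
    (c α : ℝ) : Prop where
  decomp : ∀ x ∈ M, DirectSum.IsInternal ![Lm x, Lp x, Submodule.span ℝ {v x}]
  finrank_zero : ∀ x ∈ M, Module.finrank ℝ (Submodule.span ℝ {v x}) = 1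
  finrank_minus : ∃ nm : ℕ, ∀ x ∈ M, Module.finrank ℝ (Lm x) = nm
  finrank_plus : ∃ np : ℕ, ∀ x ∈ M, Module.finrank ℝ (Lp x) = np
  continuous_minus : ContinuousOn (fun x => (Lm x).starProjection) M
  continuous_plus : ContinuousOn (fun x => (Lp x).starProjection) M
  invariant_minus : ∀ (t : ℝ), ∀ x ∈ M, (Lm x).map (X χ t x).toLinearMap = Lm (χ t x)
  invariant_plus : ∀ (t : ℝ), ∀ x ∈ M, (Lp x).map (X χ t x).toLinearMap = Lp (χ t x)
  one_le_c : 1 ≤ c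
  alpha_pos : 0 < α
  bound_minus : ∀ t : ℝ, 0 ≤ t → ∀ x ∈ M, ∀ η ∈ Lm x,
    ‖X χ t x η‖ ≤ c * Real.exp (-α * t) * ‖η‖
  bound_plus : ∀ t : ℝ, t ≤ 0 → ∀ x ∈ M, ∀ η ∈ Lp x,
    ‖X χ t x η‖ ≤ c * Real.exp (α * t) * ‖η‖

theorem IsHyperbolicAlong.isCompl {v : E → E} {χ : Flow ℝ E} {M : Set E}
    {Lm Lp : E → Submodule ℝ E} {c α : ℝ} (h : IsHyperbolicAlong v χ M Lm Lp c α)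
    {x : E} (hx : x ∈ M) : IsCompl (Lm x) (Lp x ⊔ Submodule.span ℝ {v x}) := by
  have hd := h.decomp x hx
  constructor
  · have h1 := hd.submodule_iSupIndep (0 : Fin 3)
    refine h1.mono_right (sup_le ?_ ?_)
    · exact le_iSup₂_of_le (1 : Fin 3) (by decide) le_rfl
    · exact le_iSup₂_of_le (2 : Fin 3) (by decide) le_rfl
  · rw [codisjoint_iff, eq_top_iff, ← hd.submodule_iSup_eq_top]
    refine iSup_le fun i => ?_
    fin_cases i
    · exact le_sup_left
    · exact le_sup_of_le_right le_sup_left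
    · exact le_sup_of_le_right le_sup_right

/-- The projection `P_x^-` onto `Lm x` along `Lp x ⊕ ℝ ∙ v x`. -/
def IsHyperbolicAlong.projMinus {v : E → E} {χ : Flow ℝ E} {M : Set E}
    {Lm Lp : E → Submodule ℝ E} {c α : ℝ} (h : IsHyperbolicAlong v χ M Lm Lp c α)
    {x : E} (hx : x ∈ M) : E →ₗ[ℝ] E :=
  Submodule.projection (Lm x) (Lp x ⊔ Submodule.span ℝ {v x}) (h.isCompl hx)

/-- `w(t, y, ξ) = v(χ^t(ξ) + y) - v(χ^t(ξ)) - v'(χ^t(ξ)) y`. -/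
def w (v : E → E) (χ : Flow ℝ E) (t : ℝ) (y ξ : E) : E :=
  v (χ t ξ + y) - v (χ t ξ) - fderiv ℝ v (χ t ξ) y

/-- `y` solves `ẏ = v'(χ^t(ξ)) y + w(t, y, ξ)` on `[0, ∞)` (only the values of `y` on `[0, ∞)`
matter; the derivative at `0` is one-sided). -/
def IsSolution (v : E → E) (χ : Flow ℝ E) (ξ : E) (y : ℝ → E) : Prop :=
  ∀ t : ℝ, 0 ≤ t →
    HasDerivWithinAt y (fderiv ℝ v (χ t ξ) (y t) + w v χ t (y t) ξ) (Ici 0) t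

/-- `𝒩_r(M)`, the set of pairs `(ξ, η)` with `ξ ∈ M`, `η ∈ Lm ξ`, `‖η‖ < r`. -/
def N (M : Set E) (Lm : E → Submodule ℝ E) (r : ℝ) : Set (E × E) :=
  {p | p.1 ∈ M ∧ p.2 ∈ Lm p.1 ∧ ‖p.2‖ < r}

end AsymptoticPhase

end

/-! A solution decaying like `e^{-αt}` has a forcing term `w` that is quadratic in `y`, hence of
size `e^{-2αt}`. This gap between the two rates turns the problem into a contraction (the
Lyapunov–Perron method). In the weighted variable `u = e^{αt} y`, a bounded continuous function on
`[0, ∞)`, the decaying solutions with stable component `η` are the solutions of `u = Hη + G(𝓕 u)`.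
Here `H` is the weighted linear flow on the stable plane (`Dichotomy.homogeneous`), `G` is the Green
operator of the linearized equation (`Dichotomy.green`), and `𝓕` is the superposition operator of
the weighted nonlinearity.

Three facts carry the argument. Hyperbolicity gives a dichotomy with constants uniform on `M`
(`exists_dichotomy`): the neutral direction causes no loss, because the flow carries `v` to itself
and `v` is bounded on `M`. Compactness of `M` makes the Taylor estimates uniform in `t`, so `𝓕` is
`C²` in the sup norm (`contDiff_two_nemytskii`), with small derivative on small balls. The inverse
function theorem then makes the fixed point a `C²` function of `Hη` (`exists_contDiffOn_solution`).
Since `Hη` is linear in `η`, this gives smoothness, and the quadratic bound on `𝓕 u` gives (iii).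

Joint continuity uses no contraction depending on `ξ`. Solutions are differences of two
trajectories, so only the initial value has to be continuous; it ranges in a compact ball and is
singled out by closed conditions, so every cluster point is the right one
(`continuousOn_initial_value`). -/

noncomputable section

/-! ### Superposition operators on bounded continuous functions. -/

namespace AsymptoticPhase

open BoundedContinuousFunction

section Nemytskii

variable {T E G : Type*} [TopologicalSpace T] [NormedAddCommGroup E] [NormedAddCommGroup G]

/-- A family of maps `F t : E → G`, jointly continuous, and bounded and uniformly continuous on
balls, uniformly in `t`. -/
structure UniformOnBalls (F : T → E → G) : Prop where
  cont : Continuous (fun q : T × E => F q.1 q.2)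
  bdd : ∀ R : ℝ, ∃ C : ℝ, ∀ t u, ‖u‖ ≤ R → ‖F t u‖ ≤ C
  unif : ∀ R ε : ℝ, 0 < ε → ∃ δ > 0, ∀ t u u', ‖u‖ ≤ R → ‖u'‖ ≤ R → ‖u - u'‖ < δ →
    ‖F t u - F t u'‖ ≤ ε

/-- The superposition operator `u ↦ (t ↦ F t (u t))` on bounded continuous functions. -/
def nemytskii (F : T → E → G) (hF : UniformOnBalls F) (u : T →ᵇ E) : T →ᵇ G :=
  BoundedContinuousFunction.ofNormedAddCommGroup (fun t => F t (u t))
    (hF.cont.comp (continuous_id.prodMk u.continuous)) (hF.bdd ‖u‖).choose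
    fun t => (hF.bdd ‖u‖).choose_spec t (u t) (u.norm_coe_le_norm t)

@[simp]
theorem nemytskii_apply (F : T → E → G) (hF : UniformOnBalls F) (u : T →ᵇ E) (t : T) :
    nemytskii F hF u t = F t (u t) := rfl

theorem continuous_nemytskii (F : T → E → G) (hF : UniformOnBalls F) :
    Continuous (nemytskii F hF) := by
  rw [Metric.continuous_iff]
  intro u ε hε
  obtain ⟨δ, hδ, h⟩ := hF.unif (‖u‖ + 1) (ε / 2) (by positivity)
  refine ⟨min δ 1, by positivity, fun u' hu' => ?_⟩
  rw [dist_eq_norm] at hu' ⊢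
  have h1 : ‖u'‖ ≤ ‖u‖ + 1 := by
    have := norm_sub_norm_le u' u
    have := hu'.le.trans (min_le_right _ _)
    linarith
  refine lt_of_le_of_lt ((BoundedContinuousFunction.norm_le (by positivity)).2 fun t => ?_)
    (half_lt_self hε)
  refine h t (u' t) (u t) ((u'.norm_coe_le_norm t).trans h1)
    ((u.norm_coe_le_norm t).trans (by linarith)) ?_
  exact lt_of_le_of_lt ((u' - u).norm_coe_le_norm t) (hu'.trans_le (min_le_left _ _))

variable [NormedSpace ℝ E] [NormedSpace ℝ G]

/-- A derivative bounded on balls makes `F t` Lipschitz there, uniformly in `t`; vanishing at `0`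
turns this into a bound. Thus uniformity has to be checked by hand only for the highest derivative.
-/
theorem UniformOnBalls.of_hasFDerivAt {F : T → E → G} {F' : T → E → E →L[ℝ] G}
    (hF' : UniformOnBalls F') (hc : Continuous (fun q : T × E => F q.1 q.2))
    (h0 : ∀ t, F t 0 = 0) (hd : ∀ t u, HasFDerivAt (F t) (F' t u) u) : UniformOnBalls F := by
  have lip : ∀ R : ℝ, ∃ C : ℝ, 0 < C ∧ ∀ t u u', ‖u‖ ≤ R → ‖u'‖ ≤ R →
      ‖F t u - F t u'‖ ≤ C * ‖u - u'‖ := by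
    intro R
    obtain ⟨C, hC⟩ := hF'.bdd R
    refine ⟨max C 1, by positivity, fun t u u' hu hu' => ?_⟩
    exact (convex_closedBall (0 : E) R).norm_image_sub_le_of_norm_hasFDerivWithin_le
      (f' := F' t) (fun x _ => (hd t x).hasFDerivWithinAt)
      (fun x hx => (hC t x (by simpa using hx)).trans (le_max_left _ _))
      (by simpa using hu') (by simpa using hu)
  refine ⟨hc, fun R => ?_, fun R ε hε => ?_⟩
  · obtain ⟨C, hC, h⟩ := lip R
    refine ⟨C * R, fun t u hu => ?_⟩
    have := h t u 0 hu (by simpa using (norm_nonneg u).trans hu)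
    rw [h0, sub_zero, sub_zero] at this
    exact this.trans (by gcongr)
  · obtain ⟨C, hC, h⟩ := lip R
    refine ⟨ε / C, by positivity, fun t u u' hu hu' huu => (h t u u' hu hu').trans ?_⟩
    rw [lt_div_iff₀ hC] at huu
    linarith

variable (T E G) in
/-- Pointwise application of a bounded continuous field of continuous linear maps. -/
def applyL : (T →ᵇ (E →L[ℝ] G)) →L[ℝ] (T →ᵇ E) →L[ℝ] (T →ᵇ G) :=
  LinearMap.mkContinuous₂
    (LinearMap.mk₂ ℝ
      (fun (A : T →ᵇ (E →L[ℝ] G)) (u : T →ᵇ E) =>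
        BoundedContinuousFunction.ofNormedAddCommGroup (fun t => A t (u t))
        (A.continuous.clm_apply u.continuous) (‖A‖ * ‖u‖)
        fun t => (A t).le_of_opNorm_le_of_le (A.norm_coe_le_norm t) (u.norm_coe_le_norm t))
      (fun _ _ _ => by ext; simp) (fun _ _ _ => by ext; simp)
      (fun _ _ _ => by ext; simp) (fun _ _ _ => by ext; simp))
    1 fun A u => by
      rw [one_mul]
      exact (BoundedContinuousFunction.norm_le (mul_nonneg (norm_nonneg A) (norm_nonneg u))).2
        fun t => (A t).le_of_opNorm_le_of_le (A.norm_coe_le_norm t) (u.norm_coe_le_norm t)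

theorem norm_applyL_le (A : T →ᵇ (E →L[ℝ] G)) : ‖applyL T E G A‖ ≤ ‖A‖ :=
  ContinuousLinearMap.opNorm_le_bound _ (norm_nonneg A) fun u =>
    (BoundedContinuousFunction.norm_le (mul_nonneg (norm_nonneg A) (norm_nonneg u))).2 fun t =>
      (A t).le_of_opNorm_le_of_le (A.norm_coe_le_norm t) (u.norm_coe_le_norm t)

/-- The mean value inequality at each `t` bounds the remainder by the oscillation of `F' t` near `u
t`; its modulus of continuity is independent of `t`, so the estimate survives the supremum. -/
theorem hasFDerivAt_nemytskii {F : T → E → G} {F' : T → E → E →L[ℝ] G}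
    (hF : UniformOnBalls F) (hF' : UniformOnBalls F')
    (hd : ∀ t u, HasFDerivAt (F t) (F' t u) u) (u : T →ᵇ E) :
    HasFDerivAt (nemytskii F hF) (applyL T E G (nemytskii F' hF' u)) u := by
  rw [hasFDerivAt_iff_isLittleO_nhds_zero, Asymptotics.isLittleO_iff]
  intro ε hε
  obtain ⟨δ, hδ, h⟩ := hF'.unif (‖u‖ + 1) ε hε
  have hball : Metric.ball (0 : T →ᵇ E) (min δ 1) ∈ 𝓝 0 :=
    Metric.ball_mem_nhds _ (by positivity)
  filter_upwards [hball] with k hk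
  rw [mem_ball_zero_iff] at hk
  refine (BoundedContinuousFunction.norm_le (by positivity)).2 fun t => ?_
  have hkt : ‖k t‖ ≤ ‖k‖ := k.norm_coe_le_norm t
  have hut : ‖u t‖ ≤ ‖u‖ := u.norm_coe_le_norm t
  have hmv := (convex_ball (u t) (min δ 1)).norm_image_sub_le_of_norm_hasFDerivWithin_le'
    (f := F t) (f' := F' t) (φ := F' t (u t)) (C := ε) (x := u t) (y := u t + k t)
    (fun x _ => (hd t x).hasFDerivWithinAt)
    (fun x hx => by
      rw [mem_ball_iff_norm] at hx
      refine h t x (u t) ?_ (by linarith) (hx.trans_le (min_le_left _ _))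
      have h1 := norm_sub_norm_le x (u t)
      have h2 := hx.le.trans (min_le_right _ _)
      linarith)
    (Metric.mem_ball_self (by positivity))
    (by rw [mem_ball_iff_norm]; simpa using lt_of_le_of_lt hkt hk)
  rw [add_sub_cancel_left] at hmv
  exact hmv.trans (mul_le_mul_of_nonneg_left hkt hε.le)

/-- The derivative is the continuous linear map `applyL` after the superposition operator of `F'`,
so the same reasoning applies once more. -/
theorem contDiff_two_nemytskii {F : T → E → G} {F' : T → E → E →L[ℝ] G}
    {F'' : T → E → E →L[ℝ] E →L[ℝ] G}
    (hF : UniformOnBalls F) (hF' : UniformOnBalls F') (hF'' : UniformOnBalls F'')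
    (hd : ∀ t u, HasFDerivAt (F t) (F' t u) u) (hd' : ∀ t u, HasFDerivAt (F' t) (F'' t u) u) :
    ContDiff ℝ 2 (nemytskii F hF) := by
  have h1 : ContDiff ℝ 1 (nemytskii F' hF') := by
    rw [contDiff_one_iff_fderiv]
    refine ⟨fun u => (hasFDerivAt_nemytskii hF' hF'' hd' u).differentiableAt, ?_⟩
    rw [funext fun u => (hasFDerivAt_nemytskii hF' hF'' hd' u).fderiv]
    exact (applyL T E (E →L[ℝ] G)).continuous.comp (continuous_nemytskii F'' hF'')
  rw [show (2 : WithTop ℕ∞) = 1 + 1 from (one_add_one_eq_two).symm, contDiff_succ_iff_fderiv]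
  refine ⟨fun u => (hasFDerivAt_nemytskii hF hF' hd u).differentiableAt, by simp, ?_⟩
  rw [funext fun u => (hasFDerivAt_nemytskii hF hF' hd u).fderiv]
  exact (applyL T E G).contDiff.comp h1

end Nemytskii

end AsymptoticPhase

/-! ### Smooth dependence of the fixed point. -/

namespace AsymptoticPhase

/-- The equation `u = g + Ψ u` with a contraction `Ψ` of class `C²` is uniquely solvable for
small `g`, and the solution is a `C²` function of `g`. -/
theorem exists_contDiffOn_solution {Y : Type*} [NormedAddCommGroup Y] [NormedSpace ℝ Y]
    [CompleteSpace Y] {Ψ : Y → Y} (hΨ : ContDiff ℝ 2 Ψ) (h0 : Ψ 0 = 0) {R : ℝ} (hR : 0 < R)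
    (hd : ∀ u ∈ Metric.closedBall (0 : Y) R, ‖fderiv ℝ Ψ u‖ ≤ 1 / 2) :
    ∃ S : Y → Y, (∀ g ∈ Metric.ball (0 : Y) (R / 2),
        S g = g + Ψ (S g) ∧ ‖S g‖ ≤ 2 * ‖g‖ ∧
        ∀ u ∈ Metric.closedBall (0 : Y) R, u = g + Ψ u → u = S g) ∧
      ContDiffOn ℝ 2 S (Metric.ball 0 (R / 2)) := by
  have hdiff : Differentiable ℝ Ψ := hΨ.differentiable (by norm_num)
  have lip : ∀ u ∈ Metric.closedBall (0 : Y) R, ∀ u' ∈ Metric.closedBall (0 : Y) R,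
      ‖Ψ u - Ψ u'‖ ≤ 1 / 2 * ‖u - u'‖ := fun u hu u' hu' =>
    (convex_closedBall (0 : Y) R).norm_image_sub_le_of_norm_fderiv_le
      (fun x _ => hdiff x) hd hu' hu
  have hz : (0 : Y) ∈ Metric.closedBall (0 : Y) R := by simp [hR.le]
  have uniq : ∀ g : Y, ∀ u ∈ Metric.closedBall (0 : Y) R, ∀ u' ∈ Metric.closedBall (0 : Y) R,
      u = g + Ψ u → u' = g + Ψ u' → u = u' := by
    intro g u hu u' hu' e e'
    have h1 := lip u hu u' hu'
    have h2 : Ψ u - Ψ u' = u - u' := by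
      nth_rewrite 2 [e]; nth_rewrite 2 [e']; abel
    rw [h2] at h1
    have h3 : ‖u - u'‖ ≤ 0 := by linarith [norm_nonneg (u - u')]
    exact sub_eq_zero.1 (norm_le_zero_iff.1 h3)
  have ex : ∀ g ∈ Metric.ball (0 : Y) (R / 2), ∃ u ∈ Metric.closedBall (0 : Y) R,
      u = g + Ψ u := by
    intro g hg
    rw [mem_ball_zero_iff] at hg
    have hmaps : MapsTo (fun u => g + Ψ u) (Metric.closedBall (0 : Y) R)
        (Metric.closedBall (0 : Y) R) := by
      intro u hu
      have h1 := lip u hu 0 hz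
      rw [mem_closedBall_zero_iff] at hu ⊢
      rw [h0, sub_zero, sub_zero] at h1
      have := norm_add_le g (Ψ u)
      linarith
    have hcon : ContractingWith (1 / 2) (hmaps.restrict _ _ _) := by
      refine ⟨by norm_num, LipschitzWith.of_dist_le_mul fun u u' => ?_⟩
      have := lip u u.2 u' u'.2
      rw [Subtype.dist_eq, Subtype.dist_eq, dist_eq_norm, dist_eq_norm]
      simpa using this
    obtain ⟨u, hu, hfix, -⟩ := hcon.exists_fixedPoint' Metric.isClosed_closedBall.isComplete
      hmaps hz (edist_ne_top _ _)
    exact ⟨u, hu, hfix.symm⟩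
  choose! S hS hSe using ex
  have hnorm : ∀ g ∈ Metric.ball (0 : Y) (R / 2), ‖S g‖ ≤ 2 * ‖g‖ := by
    intro g hg
    have h1 := lip (S g) (hS g hg) 0 hz
    rw [h0, sub_zero, sub_zero] at h1
    have h2 := norm_add_le g (Ψ (S g))
    rw [← hSe g hg] at h2
    linarith
  refine ⟨S, fun g hg => ⟨hSe g hg, hnorm g hg, fun u hu e =>
    uniq g u hu _ (hS g hg) e (hSe g hg)⟩, fun g hg => ContDiffAt.contDiffWithinAt ?_⟩
  -- `S` inverts `u ↦ u - Ψ u`, whose derivative is invertible by the Neumann series since `‖Ψ'‖ ≤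
  -- 1/2`.
  have hΦ : ContDiffAt ℝ 2 (fun u => u - Ψ u) (S g) := (contDiff_id.sub hΨ).contDiffAt
  have hunit : ‖fderiv ℝ Ψ (S g)‖ < 1 := (hd _ (hS g hg)).trans_lt (by norm_num)
  let e : Y ≃L[ℝ] Y := ContinuousLinearEquiv.unitsEquiv ℝ Y (Units.oneSub _ hunit)
  have hΦ' : HasFDerivAt (fun u => u - Ψ u) (e : Y →L[ℝ] Y) (S g) :=
    (hasFDerivAt_id (S g)).sub (hdiff (S g)).hasFDerivAt
  have hinv := hΦ.to_localInverse hΦ' (by norm_num)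
  have himg : S g - Ψ (S g) = g := by
    nth_rewrite 1 [hSe g hg]; abel
  simp only [himg] at hinv
  refine hinv.congr_of_eventuallyEq ?_
  have hlt : ‖S g‖ < R := by
    have := hnorm g hg
    rw [mem_ball_zero_iff] at hg
    linarith
  have hval : hΦ.localInverse hΦ' (by norm_num) g = S g := by
    have := hΦ.localInverse_apply_image hΦ' (by norm_num)
    simpa only [himg] using this
  -- Near `g` the local inverse takes values in the ball where solutions are unique, so it coincides
  -- with `S`. This uses the strict inequality `‖S g‖ < R`.
  have hnear : ∀ᶠ g' in 𝓝 g, hΦ.localInverse hΦ' (by norm_num) g' ∈ Metric.ball (0 : Y) R := by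
    refine hinv.continuousAt.eventually_mem ?_
    rw [hval]
    exact Metric.isOpen_ball.mem_nhds (by simpa using hlt)
  have hright : ∀ᶠ g' in 𝓝 g, hΦ.localInverse hΦ' (by norm_num) g' -
      Ψ (hΦ.localInverse hΦ' (by norm_num) g') = g' := by
    have := (hΦ.hasStrictFDerivAt' hΦ' (by norm_num)).eventually_right_inverse
    rw [himg] at this
    exact this
  filter_upwards [hnear, hright, Metric.isOpen_ball.mem_nhds hg] with g' h1 h2 h3
  refine uniq g' _ (hS g' h3) _ (Metric.ball_subset_closedBall h1) (hSe g' h3) ?_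
  nth_rewrite 2 [← h2]; abel

end AsymptoticPhase

/-! ### Exponential dichotomies and the Green operator. -/

namespace AsymptoticPhase

open BoundedContinuousFunction MeasureTheory
open scoped NNReal

theorem norm_setIntegral_le_of_norm_le_exp {E : Type*} [NormedAddCommGroup E] [NormedSpace ℝ E]
    {f : ℝ → E} {S : Set ℝ} {C α : ℝ} (hS : MeasurableSet S) (hS0 : S ⊆ Ioi 0) (hα : 0 < α)
    (hC : 0 ≤ C) (hf : ∀ s ∈ S, ‖f s‖ ≤ C * Real.exp (-α * s)) :
    ‖∫ s in S, f s‖ ≤ C / α := by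
  have hint : IntegrableOn (fun s => C * Real.exp (-α * s)) (Ioi 0) :=
    (exp_neg_integrableOn_Ioi 0 hα).const_mul C
  have hval : ∫ s in Ioi (0 : ℝ), C * Real.exp (-α * s) = C / α := by
    rw [integral_const_mul, integral_exp_mul_Ioi (by linarith)]
    simp [div_eq_mul_inv]
  calc ‖∫ s in S, f s‖ ≤ ∫ s in S, C * Real.exp (-α * s) :=
        norm_integral_le_of_norm_le (hint.mono_set hS0) (ae_restrict_of_forall_mem hS hf)
    _ ≤ ∫ s in Ioi (0 : ℝ), C * Real.exp (-α * s) :=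
        setIntegral_mono_set hint (Eventually.of_forall fun s => by positivity)
          hS0.eventuallyLE
    _ = C / α := hval

/-- A dichotomy on `[0, ∞)` of the linear equation `ẏ = A(t) y` with fundamental solution `U` and
inverse `V = U⁻¹`: solutions starting in the range of the projection `P` decay like `e^{-αt}`,
those starting in its kernel are bounded in backward time. -/
structure Dichotomy {E : Type*} [NormedAddCommGroup E] [NormedSpace ℝ E]
    (A U V : ℝ → E →L[ℝ] E) (P : E →L[ℝ] E) (B K α : ℝ) : Prop where
  hasDerivAt : ∀ t, HasDerivAt U (A t ∘L U t) t
  apply_zero : U 0 = ContinuousLinearMap.id ℝ E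
  left_inv : ∀ t x, V t (U t x) = x
  right_inv : ∀ t x, U t (V t x) = x
  continuous_inv : Continuous V
  norm_le : ∀ t, ‖A t‖ ≤ B
  proj : ∀ x, P (P x) = P x
  alpha_pos : 0 < α
  stable : ∀ s t, 0 ≤ s → s ≤ t → ∀ x,
    ‖U t (P (V s x))‖ ≤ K * Real.exp (-α * (t - s)) * ‖x‖
  unstable : ∀ s t, 0 ≤ t → t ≤ s → ∀ x, ‖U t (V s x - P (V s x))‖ ≤ K * ‖x‖

namespace Dichotomy

variable {E : Type*} [NormedAddCommGroup E] [NormedSpace ℝ E]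
  {A U V : ℝ → E →L[ℝ] E} {P : E →L[ℝ] E} {B K α : ℝ}

theorem continuous (h : Dichotomy A U V P B K α) : Continuous U :=
  continuous_iff_continuousAt.2 fun t => (h.hasDerivAt t).continuousAt

/-- The inhomogeneity `e^{-2αs} F(s)`, transported to time `0`. -/
def pullback (V : ℝ → E →L[ℝ] E) (α : ℝ) (F : ℝ≥0 →ᵇ E) (s : ℝ) : E :=
  V s (Real.exp (-2 * α * s) • F s.toNNReal)

/-- Truncation by `toNNReal` extends `F` continuously by its value at `0`, so the integrals below
are differentiable at every real time. -/
theorem continuous_pullback (h : Dichotomy A U V P B K α) (F : ℝ≥0 →ᵇ E) :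
    Continuous (pullback V α F) := by
  have := h.continuous_inv
  have := F.continuous
  have := continuous_real_toNNReal
  unfold pullback
  fun_prop

/-- The forcing weight `e^{-2αs}` is spent twice: as `t ≤ s`, one factor `e^{-αs}` pays for the
decay in `t`, and the other makes the integral over `s` converge. -/
theorem norm_unstable_pullback_le (h : Dichotomy A U V P B K α) (hK : 0 ≤ K) (F : ℝ≥0 →ᵇ E)
    {s t : ℝ} (ht : 0 ≤ t) (hts : t ≤ s) :
    ‖U t (pullback V α F s - P (pullback V α F s))‖
      ≤ K * ‖F‖ * Real.exp (-α * t) * Real.exp (-α * s) := by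
  refine (h.unstable s t ht hts _).trans ?_
  rw [norm_smul, Real.norm_of_nonneg (Real.exp_pos _).le, mul_assoc (K * ‖F‖), ← Real.exp_add]
  have h1 : Real.exp (-2 * α * s) ≤ Real.exp (-α * t + -α * s) :=
    Real.exp_le_exp.2 (by nlinarith [h.alpha_pos])
  calc K * (Real.exp (-2 * α * s) * ‖F s.toNNReal‖)
      ≤ K * (Real.exp (-α * t + -α * s) * ‖F‖) := by
        gcongr
        exact F.norm_coe_le_norm _
    _ = _ := by ring

theorem norm_stable_pullback_le (h : Dichotomy A U V P B K α) (hK : 0 ≤ K) (F : ℝ≥0 →ᵇ E)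
    {s t : ℝ} (hs : 0 ≤ s) (hst : s ≤ t) :
    ‖U t (P (pullback V α F s))‖ ≤ K * ‖F‖ * Real.exp (-α * t) * Real.exp (-α * s) := by
  refine (h.stable s t hs hst _).trans ?_
  rw [norm_smul, Real.norm_of_nonneg (Real.exp_pos _).le]
  have h1 : Real.exp (-α * t) * Real.exp (-α * s) =
      Real.exp (-α * (t - s)) * Real.exp (-2 * α * s) := by
    rw [← Real.exp_add, ← Real.exp_add]; ring_nf
  calc K * Real.exp (-α * (t - s)) * (Real.exp (-2 * α * s) * ‖F s.toNNReal‖)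
      = K * (Real.exp (-α * (t - s)) * Real.exp (-2 * α * s)) * ‖F s.toNNReal‖ := by ring
    _ ≤ K * (Real.exp (-α * (t - s)) * Real.exp (-2 * α * s)) * ‖F‖ := by
        gcongr
        exact F.norm_coe_le_norm _
    _ = _ := by rw [← h1]; ring

theorem integrableOn_unstable (h : Dichotomy A U V P B K α) (hK : 0 ≤ K) (F : ℝ≥0 →ᵇ E) :
    IntegrableOn (fun s => pullback V α F s - P (pullback V α F s)) (Ioi 0) := by
  have hc := h.continuous_pullback F
  refine Integrable.mono' (((exp_neg_integrableOn_Ioi 0 h.alpha_pos).const_mul (K * ‖F‖)))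
    (hc.sub (P.continuous.comp hc)).aestronglyMeasurable
    (ae_restrict_of_forall_mem measurableSet_Ioi fun s hs => ?_)
  have := h.norm_unstable_pullback_le hK F le_rfl (le_of_lt (mem_Ioi.1 hs))
  simpa [h.apply_zero] using this

/-- The initial value in `ker P` which makes the solution of the inhomogeneous equation decay. -/
def defect (V : ℝ → E →L[ℝ] E) (P : E →L[ℝ] E) (α : ℝ) (F : ℝ≥0 →ᵇ E) : E :=
  ∫ s in Ioi (0 : ℝ), (pullback V α F s - P (pullback V α F s))

/-- The decaying solution of the inhomogeneous equation with stable component `0` at time `0`. -/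
def decaying (U V : ℝ → E →L[ℝ] E) (P : E →L[ℝ] E) (α : ℝ) (F : ℝ≥0 →ᵇ E) (t : ℝ) : E :=
  U t ((∫ s in (0 : ℝ)..t, pullback V α F s) - defect V P α F)

theorem decaying_add (h : Dichotomy A U V P B K α) (hK : 0 ≤ K) (F G : ℝ≥0 →ᵇ E) (t : ℝ) :
    decaying U V P α (F + G) t = decaying U V P α F t + decaying U V P α G t := by
  have e : ∀ s, pullback V α (F + G) s = pullback V α F s + pullback V α G s := fun s => by
    simp [pullback, smul_add]
  have hd : defect V P α (F + G) = defect V P α F + defect V P α G := by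
    rw [defect, defect, defect,
      ← integral_add (h.integrableOn_unstable hK F) (h.integrableOn_unstable hK G)]
    congr 1
    ext s
    rw [e, map_add]; abel
  rw [decaying, decaying, decaying, hd, ← map_add]
  simp_rw [e]
  rw [intervalIntegral.integral_add ((h.continuous_pullback F).intervalIntegrable _ _)
    ((h.continuous_pullback G).intervalIntegrable _ _)]
  congr 1; abel

theorem decaying_smul (a : ℝ) (F : ℝ≥0 →ᵇ E) (t : ℝ) :
    decaying U V P α (a • F) t = a • decaying U V P α F t := by
  have e : ∀ s, pullback V α (a • F) s = a • pullback V α F s := fun s => by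
    simp [pullback, smul_comm a]
  have hd : defect V P α (a • F) = a • defect V P α F := by
    rw [defect, defect, ← integral_smul]
    congr 1
    ext s
    rw [e, map_smul, smul_sub]
  rw [decaying, decaying, hd, ← map_smul]
  simp_rw [e]
  rw [intervalIntegral.integral_smul, smul_sub]

variable [CompleteSpace E]

theorem proj_defect (h : Dichotomy A U V P B K α) (hK : 0 ≤ K) (F : ℝ≥0 →ᵇ E) :
    P (defect V P α F) = 0 := by
  rw [defect, ← P.integral_comp_comm (h.integrableOn_unstable hK F)]
  simp [h.proj]

/-- Subtracting the integral over `(0, ∞)` turns the unstable part over `(0, t]` into minus the tail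
over `(t, ∞)`. Each component is then integrated in the direction in which it is controlled. -/
theorem decaying_eq (h : Dichotomy A U V P B K α) (hK : 0 ≤ K) (F : ℝ≥0 →ᵇ E) {t : ℝ}
    (ht : 0 ≤ t) :
    decaying U V P α F t = (∫ s in Ioc 0 t, U t (P (pullback V α F s))) -
      ∫ s in Ioi t, U t (pullback V α F s - P (pullback V α F s)) := by
  have hc := h.continuous_pullback F
  have hi := h.integrableOn_unstable hK F
  have hit := hi.mono_set (Ioi_subset_Ioi ht)
  have h1 : (∫ s in (0 : ℝ)..t, pullback V α F s) =
      (∫ s in (0 : ℝ)..t, P (pullback V α F s)) +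
        ∫ s in (0 : ℝ)..t, (pullback V α F s - P (pullback V α F s)) := by
    rw [← intervalIntegral.integral_add]
    · simp
    · exact (P.continuous.comp hc).intervalIntegrable _ _
    · exact (hc.sub (P.continuous.comp hc)).intervalIntegrable _ _
  have h2 := intervalIntegral.integral_interval_add_Ioi hi hit
  have h3 : (∫ s in (0 : ℝ)..t, pullback V α F s) - defect V P α F =
      (∫ s in (0 : ℝ)..t, P (pullback V α F s)) -
        ∫ s in Ioi t, (pullback V α F s - P (pullback V α F s)) := by
    rw [defect, ← h2, h1]; abel
  rw [decaying, h3, map_sub, intervalIntegral.integral_of_le ht, (U t).integral_comp_comm hit,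
    (U t).integral_comp_comm]
  exact ((P.continuous.comp hc).continuousOn.integrableOn_Icc).mono_set Ioc_subset_Icc_self

theorem norm_decaying_le (h : Dichotomy A U V P B K α) (hK : 0 ≤ K) (F : ℝ≥0 →ᵇ E) {t : ℝ}
    (ht : 0 ≤ t) :
    ‖decaying U V P α F t‖ ≤ 2 * K / α * ‖F‖ * Real.exp (-α * t) := by
  rw [h.decaying_eq hK F ht]
  have h1 : ‖∫ s in Ioc 0 t, U t (P (pullback V α F s))‖ ≤
      K * ‖F‖ * Real.exp (-α * t) / α :=
    norm_setIntegral_le_of_norm_le_exp measurableSet_Ioc Ioc_subset_Ioi_self h.alpha_pos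
      (by positivity) fun s hs => h.norm_stable_pullback_le hK F hs.1.le hs.2
  have h2 : ‖∫ s in Ioi t, U t (pullback V α F s - P (pullback V α F s))‖ ≤
      K * ‖F‖ * Real.exp (-α * t) / α :=
    norm_setIntegral_le_of_norm_le_exp measurableSet_Ioi (Ioi_subset_Ioi ht) h.alpha_pos
      (by positivity) fun s hs => h.norm_unstable_pullback_le hK F ht (le_of_lt hs)
  calc _ ≤ _ := norm_sub_le _ _
    _ ≤ _ := add_le_add h1 h2
    _ = _ := by ring

theorem hasDerivAt_integral (h : Dichotomy A U V P B K α) (F : ℝ≥0 →ᵇ E) (b : E) (t : ℝ) :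
    HasDerivAt (fun t => U t (b + ∫ s in (0 : ℝ)..t, pullback V α F s))
      (A t (U t (b + ∫ s in (0 : ℝ)..t, pullback V α F s)) +
        Real.exp (-2 * α * t) • F t.toNNReal) t := by
  have hc := h.continuous_pullback F
  have h1 : HasDerivAt (fun t => b + ∫ s in (0 : ℝ)..t, pullback V α F s)
      (pullback V α F t) t :=
    (intervalIntegral.integral_hasDerivAt_right (hc.intervalIntegrable _ _)
      (hc.stronglyMeasurableAtFilter _ _) hc.continuousAt).const_add b
  convert (h.hasDerivAt t).clm_apply h1 using 1
  rw [pullback, h.right_inv]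
  rfl

theorem continuous_decaying (h : Dichotomy A U V P B K α) (F : ℝ≥0 →ᵇ E) :
    Continuous (decaying U V P α F) := by
  have := continuous_iff_continuousAt.2 fun t =>
    (h.hasDerivAt_integral F (-defect V P α F) t).continuousAt
  convert this using 2
  rw [decaying, sub_eq_neg_add]

theorem norm_exp_smul_decaying_le (h : Dichotomy A U V P B K α) (hK : 0 ≤ K) (F : ℝ≥0 →ᵇ E)
    (t : ℝ≥0) : ‖Real.exp (α * t) • decaying U V P α F t‖ ≤ 2 * K / α * ‖F‖ := by
  rw [norm_smul, Real.norm_of_nonneg (Real.exp_pos _).le]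
  calc _ ≤ Real.exp (α * t) * (2 * K / α * ‖F‖ * Real.exp (-α * t)) := by
        gcongr
        exact h.norm_decaying_le hK F t.2
    _ = 2 * K / α * ‖F‖ * (Real.exp (α * t) * Real.exp (-α * t)) := by ring
    _ = _ := by rw [← Real.exp_add]; simp

/-- The Green operator: it sends `F` to `e^{αt} y`, where `y` is the decaying solution of
`ẏ = A(t) y + e^{-2αt} F(t)` with stable component `0` at time `0`. -/
def green (h : Dichotomy A U V P B K α) (hK : 0 ≤ K) : (ℝ≥0 →ᵇ E) →L[ℝ] (ℝ≥0 →ᵇ E) :=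
  LinearMap.mkContinuous
    { toFun := fun F => BoundedContinuousFunction.ofNormedAddCommGroup
        (fun t : ℝ≥0 => Real.exp (α * t) • decaying U V P α F t)
        (by
          have := h.continuous_decaying F
          fun_prop)
        (2 * K / α * ‖F‖) (h.norm_exp_smul_decaying_le hK F)
      map_add' := fun F G => by
        ext t
        simp [h.decaying_add hK]
      map_smul' := fun a F => by
        ext t
        simp [decaying_smul, smul_comm a] }
    (2 * K / α) fun F => by
      have := h.alpha_pos
      exact BoundedContinuousFunction.norm_ofNormedAddCommGroup_le _ (by positivity)
        (h.norm_exp_smul_decaying_le hK F)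

@[simp]
theorem green_apply (h : Dichotomy A U V P B K α) (hK : 0 ≤ K) (F : ℝ≥0 →ᵇ E) (t : ℝ≥0) :
    h.green hK F t = Real.exp (α * t) • decaying U V P α F t := rfl

theorem norm_green_le (h : Dichotomy A U V P B K α) (hK : 0 ≤ K) :
    ‖h.green hK‖ ≤ 2 * K / α :=
  LinearMap.mkContinuous_norm_le _ (by have := h.alpha_pos; positivity) _

/-- A decaying solution of the inhomogeneous equation is determined by its stable component at
time `0`. -/
theorem eq_add_decaying (h : Dichotomy A U V P B K α) (hK : 0 ≤ K) (F : ℝ≥0 →ᵇ E) {y : ℝ → E}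
    (hy : ∀ t, 0 ≤ t → HasDerivWithinAt y
      (A t (y t) + Real.exp (-2 * α * t) • F t.toNNReal) (Ici 0) t)
    {C : ℝ} (hC : ∀ t, 0 ≤ t → ‖y t‖ ≤ C * Real.exp (-α * t)) {t : ℝ} (ht : 0 ≤ t) :
    y t = U t (P (y 0)) + decaying U V P α F t := by
  have hyz : ∀ T, 0 ≤ T → y T = U T (y 0 + ∫ s in (0 : ℝ)..T, pullback V α F s) := by
    intro T hT
    refine ODE_solution_unique_of_mem_Icc_right (a := 0) (b := T)
      (g := fun t => U t (y 0 + ∫ s in (0 : ℝ)..t, pullback V α F s)) (s := fun _ => univ)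
      (v := fun t x => A t x + Real.exp (-2 * α * t) • F t.toNNReal) (K := B.toNNReal)
      (fun t _ => ?_) (fun t ht' => ((hy t ht'.1).continuousWithinAt).mono Icc_subset_Ici_self)
      (fun t ht' => (hy t ht'.1).mono (Ici_subset_Ici.2 ht'.1)) (fun _ _ => mem_univ _)
      (fun t _ => (h.hasDerivAt_integral F (y 0) t).continuousAt.continuousWithinAt)
      (fun t _ => (h.hasDerivAt_integral F (y 0) t).hasDerivWithinAt) (fun _ _ => mem_univ _)
      (by simp [h.apply_zero]) ⟨hT, le_rfl⟩
    refine LipschitzWith.lipschitzOnWith (LipschitzWith.of_dist_le_mul fun x x' => ?_)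
    rw [dist_add_right, dist_eq_norm, dist_eq_norm, ← map_sub]
    exact (A t).le_of_opNorm_le ((h.norm_le t).trans (Real.le_coe_toNNReal B)) _
  -- `q` is the surplus component in `ker P`. Its orbit is a difference of decaying functions, while
  -- backward boundedness on `ker P` controls `q` by that orbit at any later time; hence `q = 0`.
  set q : E := y 0 - P (y 0) + defect V P α F with hq
  have hdiff : ∀ T, 0 ≤ T → y T = U T (P (y 0)) + decaying U V P α F T + U T q := by
    intro T hT
    have e : y 0 + ∫ s in (0 : ℝ)..T, pullback V α F s =
        P (y 0) + ((∫ s in (0 : ℝ)..T, pullback V α F s) - defect V P α F) + q := by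
      rw [hq]; abel
    rw [hyz T hT, decaying, ← map_add, ← map_add, ← e]
  have hPq : P q = 0 := by
    rw [hq, map_add, map_sub, h.proj, h.proj_defect hK, sub_self, add_zero]
  have hbound : ∀ T, 0 ≤ T → ‖U T q‖ ≤ (C + K * ‖y 0‖ + 2 * K / α * ‖F‖) *
      Real.exp (-α * T) := by
    intro T hT
    have h1 : U T q = y T - U T (P (y 0)) - decaying U V P α F T := by rw [hdiff T hT]; abel
    have h2 := h.stable 0 T le_rfl hT (y 0)
    have h3 : V 0 (y 0) = y 0 := by
      have := h.left_inv 0 (y 0)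
      rwa [h.apply_zero] at this
    rw [h3, sub_zero] at h2
    rw [h1]
    have := norm_sub_le (y T - U T (P (y 0))) (decaying U V P α F T)
    have := norm_sub_le (y T) (U T (P (y 0)))
    have := hC T hT
    have := h.norm_decaying_le hK F hT
    linarith
  have hq' : ∀ T, 0 ≤ T → ‖q‖ ≤ K * ((C + K * ‖y 0‖ + 2 * K / α * ‖F‖) *
      Real.exp (-α * T)) := by
    intro T hT
    have := h.unstable T 0 le_rfl hT (U T q)
    rw [h.left_inv, hPq, sub_zero, h.apply_zero] at this
    exact this.trans (mul_le_mul_of_nonneg_left (hbound T hT) hK)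
  have hlim : Tendsto (fun T => K * ((C + K * ‖y 0‖ + 2 * K / α * ‖F‖) *
      Real.exp (-α * T))) atTop (𝓝 0) := by
    have h1 : Tendsto (fun T : ℝ => Real.exp (-α * T)) atTop (𝓝 0) :=
      Real.tendsto_exp_atBot.comp (tendsto_id.const_mul_atTop_of_neg (by linarith [h.alpha_pos]))
    simpa using (h1.const_mul (C + K * ‖y 0‖ + 2 * K / α * ‖F‖)).const_mul K
  have hq0 : q = 0 := norm_le_zero_iff.1
    (ge_of_tendsto hlim ((eventually_ge_atTop 0).mono hq'))
  rw [hdiff t ht, hq0, map_zero, add_zero]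

/-- Existence part of the variation of constants formula. -/
theorem hasDerivAt_add_decaying (h : Dichotomy A U V P B K α) (F : ℝ≥0 →ᵇ E) (b : E) (t : ℝ) :
    HasDerivAt (fun t => U t b + decaying U V P α F t)
      (A t (U t b + decaying U V P α F t) + Real.exp (-2 * α * t) • F t.toNNReal) t := by
  have e : ∀ t, U t b + decaying U V P α F t =
      U t (b - defect V P α F + ∫ s in (0 : ℝ)..t, pullback V α F s) := fun t => by
    rw [decaying, ← map_add]
    congr 1; abel
  simp_rw [e]
  exact h.hasDerivAt_integral F _ t

end Dichotomy

end AsymptoticPhase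

/-! ### Uniform Taylor estimates near the compact set `M`. -/

namespace AsymptoticPhase

open scoped NNReal Pointwise

section Uniform

variable {E G : Type*} [NormedAddCommGroup E] [NormedSpace ℝ E] [FiniteDimensional ℝ E]
  [NormedAddCommGroup G]

theorem exists_norm_le_of_isCompact {g : E → G} (hg : Continuous g) {M : Set E}
    (hM : IsCompact M) (R : ℝ) : ∃ C, ∀ x ∈ M, ∀ y, ‖y‖ ≤ R → ‖g (x + y)‖ ≤ C := by
  obtain ⟨C, hC⟩ := (hM.add (isCompact_closedBall (0 : E) R)).exists_bound_of_continuousOn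
    hg.continuousOn
  exact ⟨C, fun x hx y hy => hC _ (add_mem_add hx (by simpa using hy))⟩

theorem exists_uniform_of_isCompact {g : E → G} (hg : Continuous g) {M : Set E}
    (hM : IsCompact M) (R ε : ℝ) (hε : 0 < ε) : ∃ δ > 0, ∀ x ∈ M, ∀ y y', ‖y‖ ≤ R → ‖y'‖ ≤ R →
      ‖y - y'‖ < δ → ‖g (x + y) - g (x + y')‖ ≤ ε := by
  have hu := (hM.add (isCompact_closedBall (0 : E) R)).uniformContinuousOn_of_continuous
    hg.continuousOn
  obtain ⟨δ, hδ, h⟩ := Metric.uniformContinuousOn_iff.1 hu ε hε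
  refine ⟨δ, hδ, fun x hx y y' hy hy' hyy => ?_⟩
  rw [← dist_eq_norm]
  refine (h _ (add_mem_add hx (by simpa using hy)) _ (add_mem_add hx (by simpa using hy')) ?_).le
  rwa [dist_add_left, dist_eq_norm]

end Uniform

/-- Taylor estimates for `v` on the `1`-neighbourhood of `M`. -/
structure TaylorBound {E : Type*} [NormedAddCommGroup E] [NormedSpace ℝ E] (v : E → E)
    (M : Set E) (B : ℝ) : Prop where
  pos : 0 < B
  differentiable : Differentiable ℝ v
  norm_fderiv_le : ∀ x ∈ M, ∀ y, ‖y‖ ≤ 1 → ‖fderiv ℝ v (x + y)‖ ≤ B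
  norm_fderiv_sub_le : ∀ x ∈ M, ∀ y, ‖y‖ ≤ 1 → ‖fderiv ℝ v (x + y) - fderiv ℝ v x‖ ≤ B * ‖y‖
  norm_remainder_le : ∀ x ∈ M, ∀ y, ‖y‖ ≤ 1 →
    ‖v (x + y) - v x - fderiv ℝ v x y‖ ≤ B * ‖y‖ ^ 2

theorem exists_taylorBound {E : Type*} [NormedAddCommGroup E] [NormedSpace ℝ E]
    [FiniteDimensional ℝ E] {v : E → E} (hv : ContDiff ℝ 2 v) {M : Set E} (hM : IsCompact M) :
    ∃ B, TaylorBound v M B := by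
  have hd : Differentiable ℝ v := hv.differentiable (by norm_num)
  have hv1 : ContDiff ℝ 1 (fderiv ℝ v) := hv.fderiv_right (by norm_num)
  have hd1 : Differentiable ℝ (fderiv ℝ v) := hv1.differentiable (by norm_num)
  obtain ⟨B₁, h₁⟩ := exists_norm_le_of_isCompact hv1.continuous hM 1
  obtain ⟨B₂, h₂⟩ := exists_norm_le_of_isCompact (hv1.continuous_fderiv (by norm_num)) hM 1
  have key : ∀ x ∈ M, ∀ y, ‖y‖ ≤ 1 →
      ‖fderiv ℝ v (x + y) - fderiv ℝ v x‖ ≤ max 1 (max B₁ B₂) * ‖y‖ := by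
    intro x hx y hy
    have := (convex_closedBall x 1).norm_image_sub_le_of_norm_fderiv_le
      (f := fderiv ℝ v) (C := max 1 (max B₁ B₂)) (x := x) (y := x + y) (fun z _ => hd1 z)
      (fun z hz => by
        have := h₂ x hx (z - x) (by simpa [dist_eq_norm] using hz)
        rw [add_sub_cancel] at this
        exact this.trans ((le_max_right _ _).trans (le_max_right _ _)))
      (by simp) (by simpa using hy)
    simpa using this
  refine ⟨max 1 (max B₁ B₂), by positivity, hd, fun x hx y hy => (h₁ x hx y hy).trans
    ((le_max_left _ _).trans (le_max_right _ _)), key, fun x hx y hy => ?_⟩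
  -- On the ball of radius `‖y‖` the derivative differs from the one at the centre by at most a
  -- constant times `‖y‖`; the mean value inequality supplies the second factor `‖y‖`.
  have := (convex_closedBall x ‖y‖).norm_image_sub_le_of_norm_fderiv_le'
    (f := v) (φ := fderiv ℝ v x) (C := max 1 (max B₁ B₂) * ‖y‖) (x := x) (y := x + y)
    (fun z _ => hd z)
    (fun z hz => by
      have hz' : ‖z - x‖ ≤ ‖y‖ := by simpa [dist_eq_norm] using hz
      have := key x hx (z - x) (hz'.trans hy)
      rw [add_sub_cancel] at this
      exact this.trans (by gcongr))
    (by simp) (by simp)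
  rw [add_sub_cancel_left] at this
  rwa [pow_two, ← mul_assoc]

namespace TaylorBound

/-- Serves to transfer results in forward time to the reversed flow, which `-v` generates. -/
theorem neg {E : Type*} [NormedAddCommGroup E] [NormedSpace ℝ E] {v : E → E}
    {M : Set E} {B : ℝ} (h : TaylorBound v M B) : TaylorBound (-v) M B := by
  have e : ∀ x, fderiv ℝ (-v) x = -fderiv ℝ v x := fun x => fderiv_neg
  refine ⟨h.pos, h.differentiable.neg, fun x hx y hy => ?_, fun x hx y hy => ?_,
    fun x hx y hy => ?_⟩
  · rw [e, norm_neg]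
    exact h.norm_fderiv_le x hx y hy
  · rw [e, e, ← neg_sub', norm_neg]
    exact h.norm_fderiv_sub_le x hx y hy
  · rw [e, Pi.neg_apply, Pi.neg_apply, neg_apply, ← neg_sub', ← neg_sub', norm_neg]
    exact h.norm_remainder_le x hx y hy

theorem norm_fderiv_self_le {E : Type*} [NormedAddCommGroup E] [NormedSpace ℝ E] {v : E → E}
    {M : Set E} {B : ℝ} (h : TaylorBound v M B) {x : E} (hx : x ∈ M) : ‖fderiv ℝ v x‖ ≤ B := by
  simpa using h.norm_fderiv_le x hx 0 (by simp)

theorem lipschitzOnWith {E : Type*} [NormedAddCommGroup E] [NormedSpace ℝ E] {v : E → E}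
    {M : Set E} {B : ℝ} (h : TaylorBound v M B) {x : E} (hx : x ∈ M) :
    LipschitzOnWith B.toNNReal v (Metric.closedBall x 1) := by
  refine (convex_closedBall x 1).lipschitzOnWith_of_nnnorm_fderiv_le
    (fun z _ => h.differentiable z) fun z hz => ?_
  have := h.norm_fderiv_le x hx (z - x) (by simpa [dist_eq_norm] using hz)
  rw [add_sub_cancel] at this
  exact NNReal.coe_le_coe.1 (this.trans (Real.le_coe_toNNReal B))

end TaylorBound

/-! ### Differentiability of the flow along `M` and the variational equation. -/

/-- Local solvability of the matrix equation `U' = A(t) U`, with a uniform existence time. -/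
theorem exists_local_fundamental_solution {E : Type*} [NormedAddCommGroup E] [NormedSpace ℝ E]
    [CompleteSpace E] {A : ℝ → E →L[ℝ] E} (hA : Continuous A) {B : ℝ} (hB : 0 < B)
    (hAB : ∀ t, ‖A t‖ ≤ B) :
    ∃ U : ℝ → E →L[ℝ] E, U 0 = ContinuousLinearMap.id ℝ E ∧ ∀ t ∈ Icc 0 (1 / (2 * B)),
      HasDerivWithinAt U (A t ∘L U t) (Icc 0 (1 / (2 * B))) t := by
  have hτ : 0 ≤ 1 / (2 * B) := by positivity
  -- In the unit ball about the identity `‖W‖ ≤ 2`, so the speed is at most `2B` and the ball is not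
  -- left before time `1/(2B)`.
  have hPL : IsPicardLindelof (fun t (W : E →L[ℝ] E) => A t ∘L W)
      (tmin := 0) (tmax := 1 / (2 * B)) ⟨0, le_rfl, hτ⟩ (ContinuousLinearMap.id ℝ E) 1 0
      (2 * B).toNNReal B.toNNReal := by
    refine ⟨fun t _ => LipschitzWith.lipschitzOnWith (LipschitzWith.of_dist_le_mul
      fun W W' => ?_), fun W _ => ?_, fun t _ W hW => ?_, ?_⟩
    · rw [dist_eq_norm, dist_eq_norm, ← ContinuousLinearMap.comp_sub]
      refine (ContinuousLinearMap.opNorm_comp_le _ _).trans ?_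
      gcongr
      exact (hAB t).trans (Real.le_coe_toNNReal B)
    · exact (hA.clm_comp continuous_const).continuousOn
    · have h1 : ‖W‖ ≤ 2 := by
        rw [mem_closedBall_iff_norm] at hW
        have h2 := norm_sub_norm_le W (ContinuousLinearMap.id ℝ E)
        have h3 := ContinuousLinearMap.norm_id_le (𝕜 := ℝ) (E := E)
        norm_num at hW
        linarith
      rw [Real.coe_toNNReal _ (by positivity)]
      calc _ ≤ ‖A t‖ * ‖W‖ := ContinuousLinearMap.opNorm_comp_le _ _
        _ ≤ B * 2 := by
          gcongr
          exact hAB t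
        _ = _ := by ring
    · rw [Real.coe_toNNReal _ (by positivity)]
      simp only [sub_zero, sub_self, max_eq_left hτ]
      field_simp
      simp
  exact hPL.exists_eq_forall_mem_Icc_hasDerivWithinAt₀

section Flow

variable {E : Type*} [NormedAddCommGroup E] [InnerProductSpace ℝ E]
  {v : E → E} {χ : Flow ℝ E} {M : Set E} {B : ℝ}

theorem Generates.reverse (hχ : Generates v χ) : Generates (-v) χ.reverse := by
  intro x t
  have := (hχ x (-t)).scomp t (hasDerivAt_neg t)
  simpa [Function.comp_def] using this

theorem X_zero (x : E) : X χ 0 x = ContinuousLinearMap.id ℝ E := by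
  simp [X]

/-- The curve `χ s x + U s h` solves `ẋ = v x` up to a Taylor remainder of order `‖h‖²`, so by
Grönwall it stays `O(‖h‖²)`-close to the trajectory of `x + h`. -/
theorem hasFDerivAt_flow_of_fundamental_solution (hχ : Generates v χ) (hB : TaylorBound v M B)
    (hinv : ∀ t, ∀ x ∈ M, χ t x ∈ M) {x : E} (hx : x ∈ M) {T : ℝ} {U : ℝ → E →L[ℝ] E}
    (hU0 : U 0 = ContinuousLinearMap.id ℝ E)
    (hU : ∀ t ∈ Icc 0 T, HasDerivWithinAt U (fderiv ℝ v (χ t x) ∘L U t) (Icc 0 T) t) {t : ℝ}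
    (ht : t ∈ Icc 0 T) : HasFDerivAt (fun z => χ t z) (U t) x := by
  obtain ⟨C, hC⟩ := isCompact_Icc.exists_bound_of_continuousOn
    (fun t ht => (hU t ht).continuousWithinAt : ContinuousOn U (Icc 0 T))
  have hC0 : 0 ≤ C := (norm_nonneg _).trans (hC t ht)
  -- Compactness of `[0, T]` keeps nearby trajectories in the unit tube where `v` has Lipschitz
  -- constant `B`.
  have hnear : ∀ᶠ h in 𝓝 (0 : E), ∀ s ∈ Icc 0 T, ‖χ s (x + h) - χ s x‖ < 1 := by
    refine isCompact_Icc.eventually_forall_of_forall_eventually fun s _ => ?_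
    have hcont : Continuous fun q : E × ℝ => ‖χ q.2 (x + q.1) - χ q.2 x‖ := by fun_prop
    exact hcont.continuousAt.eventually_lt continuousAt_const (by simp)
  have hsmall : ∀ᶠ h in 𝓝 (0 : E), C * ‖h‖ < 1 := by
    have hcont : Continuous fun h : E => C * ‖h‖ := by fun_prop
    exact hcont.continuousAt.eventually_lt continuousAt_const (by simp)
  rw [hasFDerivAt_iff_isLittleO_nhds_zero]
  have hO : (fun h => χ t (x + h) - χ t x - U t h) =O[𝓝 0] fun h : E => ‖h‖ ^ 2 := by
    refine Asymptotics.IsBigO.of_bound (C ^ 2 * Real.exp (B * t)) ?_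
    filter_upwards [hnear, hsmall] with h h1 h2
    have hUh : ∀ s ∈ Icc 0 T, ‖U s h‖ ≤ C * ‖h‖ := fun s hs => (U s).le_of_opNorm_le (hC s hs) h
    have hgron := dist_le_of_approx_trajectories_ODE_of_mem (v := fun _ => v)
      (s := fun s => Metric.closedBall (χ s x) 1) (K := B.toNNReal) (a := 0) (b := T)
      (f := fun s => χ s (x + h)) (f' := fun s => v (χ s (x + h)))
      (g := fun s => χ s x + U s h)
      (g' := fun s => v (χ s x) + (fderiv ℝ v (χ s x) ∘L U s) h)
      (εf := 0) (εg := B * (C * ‖h‖) ^ 2) (δ := 0)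
      (fun s _ => hB.lipschitzOnWith (hinv s x hx))
      (fun s _ => (hχ (x + h) s).continuousAt.continuousWithinAt)
      (fun s _ => (hχ (x + h) s).hasDerivWithinAt)
      (fun s _ => by simp)
      (fun s hs => by
        rw [mem_closedBall_iff_norm]
        exact (h1 s (Ico_subset_Icc_self hs)).le)
      (fun s hs => ((hχ x s).continuousAt.continuousWithinAt).add
        ((hU s hs).continuousWithinAt.clm_apply continuousWithinAt_const))
      (fun s hs => by
        have h3 := (hU s (Ico_subset_Icc_self hs)).mono_of_mem_nhdsWithin
          (Icc_mem_nhdsGE_of_mem hs)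
        have h4 := h3.clm_apply (hasDerivWithinAt_const s (Ici s) h)
        simpa using (hχ x s).hasDerivWithinAt.fun_add h4)
      (fun s hs => by
        have h3 := hUh s (Ico_subset_Icc_self hs)
        have h4 := hB.norm_remainder_le (χ s x) (hinv s x hx) (U s h) (h3.trans h2.le)
        rw [dist_comm, dist_eq_norm, ← sub_sub]
        refine h4.trans ?_
        have := hB.pos
        gcongr)
      (fun s hs => by
        rw [mem_closedBall_iff_norm, add_sub_cancel_left]
        exact (hUh s (Ico_subset_Icc_self hs)).trans h2.le)
      (by simp [hU0]) t ht
    have hBne : B ≠ 0 := hB.pos.ne'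
    rw [Real.coe_toNNReal _ hB.pos.le, gronwallBound_of_K_ne_0 hBne, dist_eq_norm,
      sub_zero, ← sub_sub] at hgron
    refine hgron.trans ?_
    rw [Real.norm_of_nonneg (by positivity)]
    have e : 0 * Real.exp (B * t) + (0 + B * (C * ‖h‖) ^ 2) / B * (Real.exp (B * t) - 1) =
        C ^ 2 * ‖h‖ ^ 2 * (Real.exp (B * t) - 1) := by
      field_simp
      ring
    refine e.trans_le ?_
    nlinarith [show 0 ≤ C ^ 2 * ‖h‖ ^ 2 by positivity]
  exact hO.trans_isLittleO (Asymptotics.isLittleO_norm_pow_id one_lt_two)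

variable [FiniteDimensional ℝ E]

theorem exists_local_derivative (hχ : Generates v χ) (hB : TaylorBound v M B)
    (hc : Continuous (fderiv ℝ v)) (hinv : ∀ t, ∀ x ∈ M, χ t x ∈ M) {x : E} (hx : x ∈ M) :
    (∀ t ∈ Icc 0 (1 / (2 * B)), DifferentiableAt ℝ (fun z => χ t z) x) ∧
      HasDerivWithinAt (fun t => X χ t x) (fderiv ℝ v x) (Ici 0) 0 := by
  have hτ : 0 < 1 / (2 * B) := by have := hB.pos; positivity
  obtain ⟨U, hU0, hU⟩ := exists_local_fundamental_solution
    (A := fun t => fderiv ℝ v (χ t x)) (by fun_prop) hB.pos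
    (fun t => hB.norm_fderiv_self_le (hinv t x hx))
  have hd := fun t ht => hasFDerivAt_flow_of_fundamental_solution hχ hB hinv hx hU0 hU (t := t) ht
  refine ⟨fun t ht => (hd t ht).differentiableAt, ?_⟩
  have h1 := (hU 0 ⟨le_rfl, hτ.le⟩).mono_of_mem_nhdsWithin (Icc_mem_nhdsGE_of_mem ⟨le_rfl, hτ⟩)
  rw [hU0, ContinuousLinearMap.comp_id, χ.map_zero_apply] at h1
  refine h1.congr_of_eventuallyEq ?_ (hd 0 ⟨le_rfl, hτ.le⟩).fderiv
  filter_upwards [Icc_mem_nhdsGE hτ] with t ht using (hd t ht).fderiv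

/-- The derivative from the left is the derivative from the right for the reversed flow. -/
theorem hasDerivAt_X_zero (hχ : Generates v χ) (hB : TaylorBound v M B)
    (hc : Continuous (fderiv ℝ v)) (hinv : ∀ t, ∀ x ∈ M, χ t x ∈ M) {x : E} (hx : x ∈ M) :
    HasDerivAt (fun t => X χ t x) (fderiv ℝ v x) 0 := by
  have e : fderiv ℝ (-v) = -fderiv ℝ v := funext fun x => fderiv_neg
  have h1 := (exists_local_derivative hχ hB hc hinv hx).2
  have h2 := (exists_local_derivative hχ.reverse hB.neg (by rw [e]; exact hc.neg)
    (fun t x hx => hinv (-t) x hx) hx).2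
  have h3 : HasDerivWithinAt (fun t => X χ t x) (fderiv ℝ v x) (Iic 0) 0 := by
    have h4 : HasDerivWithinAt (fun t => X χ.reverse t x) (fderiv ℝ (-v) x) (Ici 0) (-0) := by
      rwa [neg_zero]
    have h5 := h4.scomp (0 : ℝ) (hasDerivWithinAt_neg (0 : ℝ) (Iic 0))
      (fun t ht => by simpa using ht)
    have h6 : ((fun t => X χ.reverse t x) ∘ Neg.neg) = fun t => X χ t x := by
      ext1 t
      simp [X]
    rw [e] at h5
    simpa [← h6] using h5
  have := h1.union h3
  rw [Ici_union_Iic, hasDerivWithinAt_univ] at this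
  exact this

/-- The existence time `1/(2B)` is the same at all points of the invariant set `M`, so `χ t` is a
finite composition of short-time maps `χ (t/n)`, each differentiable along `M`. -/
theorem differentiableAt_flow (hχ : Generates v χ) (hB : TaylorBound v M B)
    (hc : Continuous (fderiv ℝ v)) (hinv : ∀ t, ∀ x ∈ M, χ t x ∈ M) (t : ℝ) {x : E}
    (hx : x ∈ M) : DifferentiableAt ℝ (fun z => χ t z) x := by
  have e : fderiv ℝ (-v) = -fderiv ℝ v := funext fun x => fderiv_neg
  have hτ : 0 < 1 / (2 * B) := by have := hB.pos; positivity
  set τ := 1 / (2 * B)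
  have hsmall : ∀ t, |t| ≤ τ → ∀ x ∈ M, DifferentiableAt ℝ (fun z => χ t z) x := by
    intro t ht x hx
    rcases le_total 0 t with h0 | h0
    · exact (exists_local_derivative hχ hB hc hinv hx).1 t ⟨h0, (le_abs_self t).trans ht⟩
    · have := (exists_local_derivative hχ.reverse hB.neg (by rw [e]; exact hc.neg)
        (fun t x hx => hinv (-t) x hx) hx).1 (-t) ⟨by linarith, (neg_le_abs t).trans ht⟩
      simpa using this
  have hmul : ∀ n : ℕ, ∀ s, |s| ≤ τ → ∀ x ∈ M, DifferentiableAt ℝ (fun z => χ (n * s) z) x := by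
    intro n s hs
    induction n with
    | zero => intro x _; simp
    | succ n ih =>
      intro x hx
      have := (ih (χ s x) (hinv s x hx)).comp x (hsmall s hs x hx)
      convert this using 1
      ext z
      rw [Function.comp_apply, ← χ.map_add]
      push_cast
      ring_nf
  obtain ⟨n, hn⟩ := exists_nat_gt (|t| / τ)
  have hn0 : (0 : ℝ) < n := lt_of_le_of_lt (by positivity) hn
  have := hmul n (t / n) (by
    rw [abs_div, Nat.abs_cast, div_le_iff₀ hn0]
    rw [div_lt_iff₀ hτ] at hn
    linarith) x hx
  rwa [mul_div_cancel₀ t hn0.ne'] at this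

theorem X_add (hχ : Generates v χ) (hB : TaylorBound v M B)
    (hc : Continuous (fderiv ℝ v)) (hinv : ∀ t, ∀ x ∈ M, χ t x ∈ M) (s t : ℝ) {x : E}
    (hx : x ∈ M) : X χ (s + t) x = X χ s (χ t x) ∘L X χ t x := by
  have h := (differentiableAt_flow hχ hB hc hinv s (hinv t x hx)).hasFDerivAt.comp x
    (differentiableAt_flow hχ hB hc hinv t hx).hasFDerivAt
  have e : (fun z => χ (s + t) z) = (fun z => χ s z) ∘ fun z => χ t z :=
    funext fun z => χ.map_add s t z
  rw [X, e]
  exact h.fderiv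

/-- The variational equation. -/
theorem hasDerivAt_X (hχ : Generates v χ) (hB : TaylorBound v M B)
    (hc : Continuous (fderiv ℝ v)) (hinv : ∀ t, ∀ x ∈ M, χ t x ∈ M) (t : ℝ) {x : E}
    (hx : x ∈ M) : HasDerivAt (fun t => X χ t x) (fderiv ℝ v (χ t x) ∘L X χ t x) t := by
  have h1 : HasDerivAt (fun s => X χ s (χ t x)) (fderiv ℝ v (χ t x)) (t - t) := by
    rw [sub_self]
    exact hasDerivAt_X_zero hχ hB hc hinv (hinv t x hx)
  have h2 := (h1.comp_sub_const t t).clm_comp (hasDerivAt_const t (X χ t x))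
  have e : (fun s => X χ s x) = fun s => X χ (s - t) (χ t x) ∘L X χ t x := by
    ext1 s
    rw [← X_add hχ hB hc hinv _ _ hx, sub_add_cancel]
  rw [e]
  simpa using h2

/-- The flow carries the vector field to itself. -/
theorem X_apply_v (hχ : Generates v χ) (hB : TaylorBound v M B)
    (hc : Continuous (fderiv ℝ v)) (hinv : ∀ t, ∀ x ∈ M, χ t x ∈ M) (t : ℝ) {x : E}
    (hx : x ∈ M) : X χ t x (v x) = v (χ t x) := by
  -- Differentiate `χ t ∘ χ s = χ s ∘ χ t` in `s` at `s = 0`.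
  have h1 : HasDerivAt (fun s => χ t (χ s x)) (X χ t x (v x)) 0 := by
    have hx0 : HasFDerivAt (fun z => χ t z) (X χ t x) (χ 0 x) := by
      rw [χ.map_zero_apply]
      exact (differentiableAt_flow hχ hB hc hinv t hx).hasFDerivAt
    have := hx0.comp_hasDerivAt (0 : ℝ) (hχ x 0)
    rwa [χ.map_zero_apply] at this
  have h2 : HasDerivAt (fun s => χ s (χ t x)) (v (χ t x)) 0 := by
    have := hχ (χ t x) 0
    rwa [χ.map_zero_apply] at this
  refine h1.unique (h2.congr_of_eventuallyEq (Eventually.of_forall fun s => ?_))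
  show χ t (χ s x) = χ s (χ t x)
  rw [← χ.map_add, ← χ.map_add, add_comm]

end Flow

end AsymptoticPhase

/-! ### From hyperbolicity along `M` to a uniform dichotomy. -/

namespace AsymptoticPhase

namespace IsHyperbolicAlong

open scoped RealInnerProductSpace

variable {E : Type*} [NormedAddCommGroup E] [InnerProductSpace ℝ E] [FiniteDimensional ℝ E]
  {v : E → E} {χ : Flow ℝ E} {M : Set E} {Lm Lp : E → Submodule ℝ E} {c α B : ℝ}

/-- The sum of the orthogonal projections onto the stable and the unstable plane and of
`⟪v, ·⟫ v`. It is invertible along `M`, and its inverse splits vectors into components. -/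
def frame (v : E → E) (Lm Lp : E → Submodule ℝ E) (x : E) : E →L[ℝ] E :=
  (Lm x).starProjection + (Lp x).starProjection + InnerProductSpace.rankOne ℝ (v x) (v x)

theorem frame_apply (x z : E) : frame v Lm Lp x z =
    (Lm x).starProjection z + (Lp x).starProjection z + ⟪v x, z⟫ • v x := by
  simp [frame]

theorem exists_decomp (h : IsHyperbolicAlong v χ M Lm Lp c α) {x : E} (hx : x ∈ M) (z : E) :
    ∃ a ∈ Lm x, ∃ b ∈ Lp x ⊔ Submodule.span ℝ {v x}, a + b = z :=
  Submodule.mem_sup.1 (by rw [(h.isCompl hx).sup_eq_top]; trivial)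

/-- The quadratic form of the frame is a sum of three squares. A kernel vector is therefore
orthogonal to both planes and to `v x`, which together span, so it vanishes. -/
theorem isUnit_frame (h : IsHyperbolicAlong v χ M Lm Lp c α) {x : E} (hx : x ∈ M) :
    IsUnit (frame v Lm Lp x) := by
  rw [ContinuousLinearMap.isUnit_iff_isUnit_toLinearMap, LinearMap.isUnit_iff_ker_eq_bot,
    LinearMap.ker_eq_bot']
  intro z hz
  have hz' : frame v Lm Lp x z = 0 := hz
  have hq : ∀ K : Submodule ℝ E, ⟪K.starProjection z, z⟫ = ‖K.starProjection z‖ ^ 2 :=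
    fun K => by
      rw [← real_inner_self_eq_norm_sq, Submodule.inner_starProjection_left_eq_right K z
        (K.starProjection z), Submodule.starProjection_eq_self_iff.2
        (Submodule.starProjection_apply_mem K z), real_inner_comm]
  have hsum : ‖(Lm x).starProjection z‖ ^ 2 + ‖(Lp x).starProjection z‖ ^ 2 +
      ⟪v x, z⟫ ^ 2 = 0 := by
    have := congrArg (fun y => ⟪y, z⟫) hz'
    simp only [frame_apply, inner_add_left, inner_zero_left, hq, real_inner_smul_left] at this
    rw [← this]; ring
  have h1 : (Lm x).starProjection z = 0 := norm_eq_zero.1 (by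
    nlinarith [sq_nonneg ‖(Lp x).starProjection z‖, sq_nonneg ⟪v x, z⟫])
  have h2 : (Lp x).starProjection z = 0 := norm_eq_zero.1 (by
    nlinarith [sq_nonneg ‖(Lm x).starProjection z‖, sq_nonneg ⟪v x, z⟫])
  have h3 : ⟪v x, z⟫ = 0 := by
    nlinarith [sq_nonneg ‖(Lm x).starProjection z‖, sq_nonneg ‖(Lp x).starProjection z‖]
  have horth : ∀ K : Submodule ℝ E, K.starProjection z = 0 → ∀ a ∈ K, ⟪a, z⟫ = 0 :=
    fun K hK a ha => by
      rw [← Submodule.starProjection_eq_self_iff.2 ha,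
        Submodule.inner_starProjection_left_eq_right, hK, inner_zero_right]
  obtain ⟨a, ha, b, hb, rfl⟩ := h.exists_decomp hx z
  obtain ⟨b', hb', b'', hb'', rfl⟩ := Submodule.mem_sup.1 hb
  obtain ⟨s, rfl⟩ := Submodule.mem_span_singleton.1 hb''
  refine inner_self_eq_zero (𝕜 := ℝ).1 ?_
  nth_rewrite 1 [inner_add_left, inner_add_left]
  rw [horth _ h1 a ha, horth _ h2 b' hb', real_inner_smul_left, h3]
  simp

/-- The projection `P⁻` as a continuous linear map depending on the base point. -/
def stableProj (v : E → E) (Lm Lp : E → Submodule ℝ E) (x : E) : E →L[ℝ] E :=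
  (Lm x).starProjection ∘L Ring.inverse (frame v Lm Lp x)

theorem frame_inverse (h : IsHyperbolicAlong v χ M Lm Lp c α) {x : E} (hx : x ∈ M) (z : E) :
    frame v Lm Lp x (Ring.inverse (frame v Lm Lp x) z) = z :=
  DFunLike.congr_fun (Ring.mul_inverse_cancel _ (h.isUnit_frame hx)) z

/-- Applying the frame to its inverse at `z` exhibits the oblique components of `z`, with bounds in
terms of the inverse frame. -/
theorem sub_stableProj (h : IsHyperbolicAlong v χ M Lm Lp c α) {x : E} (hx : x ∈ M) (z : E) :
    z - stableProj v Lm Lp x z =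
      (Lp x).starProjection (Ring.inverse (frame v Lm Lp x) z) +
        ⟪v x, Ring.inverse (frame v Lm Lp x) z⟫ • v x := by
  nth_rewrite 1 [← h.frame_inverse hx z]
  rw [frame_apply, stableProj, ContinuousLinearMap.comp_apply]
  abel

theorem stableProj_mem (x z : E) : stableProj v Lm Lp x z ∈ Lm x :=
  Submodule.starProjection_apply_mem _ _

theorem sub_stableProj_mem (h : IsHyperbolicAlong v χ M Lm Lp c α) {x : E} (hx : x ∈ M)
    (z : E) : z - stableProj v Lm Lp x z ∈ Lp x ⊔ Submodule.span ℝ {v x} := by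
  rw [h.sub_stableProj hx]
  exact Submodule.add_mem_sup (Submodule.starProjection_apply_mem _ _)
    (Submodule.smul_mem _ _ (Submodule.mem_span_singleton_self _))

theorem stableProj_eq (h : IsHyperbolicAlong v χ M Lm Lp c α) {x : E} (hx : x ∈ M) {a b : E}
    (ha : a ∈ Lm x) (hb : b ∈ Lp x ⊔ Submodule.span ℝ {v x}) :
    stableProj v Lm Lp x (a + b) = a := by
  have hd := (h.isCompl hx).disjoint
  rw [Submodule.disjoint_def] at hd
  have e : stableProj v Lm Lp x (a + b) - a =
      b - (a + b - stableProj v Lm Lp x (a + b)) := by abel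
  refine sub_eq_zero.1 (hd _ (Submodule.sub_mem _ (stableProj_mem _ _) ha) ?_)
  rw [e]
  exact Submodule.sub_mem _ hb (h.sub_stableProj_mem hx _)

theorem stableProj_of_mem (h : IsHyperbolicAlong v χ M Lm Lp c α) {x : E} (hx : x ∈ M) {a : E}
    (ha : a ∈ Lm x) : stableProj v Lm Lp x a = a := by
  simpa using h.stableProj_eq hx ha (Submodule.zero_mem _)

theorem projMinus_eq (h : IsHyperbolicAlong v χ M Lm Lp c α) {x : E} (hx : x ∈ M) (z : E) :
    h.projMinus hx z = stableProj v Lm Lp x z := by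
  obtain ⟨a, ha, b, hb, rfl⟩ := h.exists_decomp hx z
  rw [h.stableProj_eq hx ha hb, projMinus, map_add, Submodule.projection_apply_of_mem_left _ ha,
    Submodule.projection_apply_of_mem_right _ hb, add_zero]

/-- This is the purpose of the frame: it is visibly continuous, inversion is continuous at units,
and so the oblique projection inherits continuity, and uniform bounds on `M`, from the orthogonal
ones. -/
theorem continuousOn_inverse_frame (h : IsHyperbolicAlong v χ M Lm Lp c α)
    (hv : Continuous v) : ContinuousOn (fun x => Ring.inverse (frame v Lm Lp x)) M := by
  have hf : ContinuousOn (frame v Lm Lp) M := by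
    refine (h.continuous_minus.add h.continuous_plus).add (Continuous.continuousOn ?_)
    exact ((ContinuousLinearMap.smulRightL ℝ E E).continuous.comp
      ((innerSL ℝ).continuous.comp hv)).clm_apply hv
  intro x hx
  obtain ⟨u, hu⟩ := h.isUnit_frame hx
  have := NormedRing.inverse_continuousAt u
  rw [hu] at this
  exact this.comp_continuousWithinAt (hf x hx)

theorem continuousOn_stableProj (h : IsHyperbolicAlong v χ M Lm Lp c α)
    (hv : Continuous v) : ContinuousOn (stableProj v Lm Lp) M :=
  h.continuous_minus.clm_comp (h.continuousOn_inverse_frame hv)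

theorem stableProj_X (h : IsHyperbolicAlong v χ M Lm Lp c α) (hχ : Generates v χ)
    (hB : TaylorBound v M B) (hc : Continuous (fderiv ℝ v)) (hinv : ∀ t, ∀ x ∈ M, χ t x ∈ M)
    (t : ℝ) {x : E} (hx : x ∈ M) (z : E) :
    stableProj v Lm Lp (χ t x) (X χ t x z) = X χ t x (stableProj v Lm Lp x z) := by
  obtain ⟨a, ha, b, hb, rfl⟩ := h.exists_decomp hx z
  rw [h.stableProj_eq hx ha hb, map_add]
  refine h.stableProj_eq (hinv t x hx) ?_ ?_
  · rw [← h.invariant_minus t x hx]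
    exact Submodule.mem_map_of_mem ha
  · obtain ⟨b', hb', b'', hb'', rfl⟩ := Submodule.mem_sup.1 hb
    obtain ⟨s, rfl⟩ := Submodule.mem_span_singleton.1 hb''
    rw [map_add, map_smul, X_apply_v hχ hB hc hinv t hx]
    refine Submodule.add_mem_sup ?_ (Submodule.smul_mem _ _ (Submodule.mem_span_singleton_self _))
    rw [← h.invariant_plus t x hx]
    exact Submodule.mem_map_of_mem hb'

theorem exists_dichotomy (h : IsHyperbolicAlong v χ M Lm Lp c α) (hχ : Generates v χ)
    (hM : IsCompact M)
    (hB : TaylorBound v M B) (hc : Continuous (fderiv ℝ v)) (hinv : ∀ t, ∀ x ∈ M, χ t x ∈ M) :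
    ∃ K > 0, ∀ x ∈ M, Dichotomy (fun t => fderiv ℝ v (χ t x)) (fun t => X χ t x)
      (fun t => X χ (-t) (χ t x)) (stableProj v Lm Lp x) B K α := by
  have hv : Continuous v := hB.differentiable.continuous
  obtain ⟨q, hq⟩ := hM.exists_bound_of_continuousOn (h.continuousOn_inverse_frame hv)
  obtain ⟨b, hb⟩ := hM.exists_bound_of_continuousOn hv.continuousOn
  have hc1 := h.one_le_c
  have hα := h.alpha_pos
  set q' := max q 1
  have hq' : ∀ x ∈ M, ∀ z, ‖Ring.inverse (frame v Lm Lp x) z‖ ≤ q' * ‖z‖ := fun x hx z =>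
    ContinuousLinearMap.le_of_opNorm_le _ ((hq x hx).trans (le_max_left _ _)) z
  have hproj : ∀ (K : Submodule ℝ E) z, ‖K.starProjection z‖ ≤ ‖z‖ := fun K z => by
    simpa using K.starProjection.le_of_opNorm_le K.starProjection_norm_le z
  -- `q'` bounds the inverse frame, `c` is the hyperbolicity constant, and `b ^ 2` bounds the
  -- neutral term `⟪v, u⟫ • v`, in which `v` occurs twice.
  refine ⟨(c + b ^ 2) * q', by positivity, fun x hx => ?_⟩
  have hback : ∀ t, χ (-t) (χ t x) = x := fun t => by
    rw [← χ.map_add, neg_add_cancel, χ.map_zero_apply]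
  have left_inv : ∀ t z, X χ (-t) (χ t x) (X χ t x z) = z := fun t z => by
    have := X_add hχ hB hc hinv (-t) t hx
    rw [neg_add_cancel, X_zero] at this
    exact (DFunLike.congr_fun this z).symm
  have right_inv : ∀ t z, X χ t x (X χ (-t) (χ t x) z) = z := fun t z => by
    have := X_add hχ hB hc hinv t (-t) (hinv t x hx)
    rw [add_neg_cancel, X_zero, hback] at this
    exact (DFunLike.congr_fun this z).symm
  have hcU : Continuous fun t => X χ t x :=
    continuous_iff_continuousAt.2 fun t => (hasDerivAt_X hχ hB hc hinv t hx).continuousAt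
  have hcV : Continuous fun t => X χ (-t) (χ t x) := by
    let u : ℝ → (E →L[ℝ] E)ˣ := fun t => ⟨X χ t x, X χ (-t) (χ t x),
      ContinuousLinearMap.ext (right_inv t), ContinuousLinearMap.ext (left_inv t)⟩
    have e : (fun t => X χ (-t) (χ t x)) = fun t => Ring.inverse (X χ t x) :=
      funext fun t => (Ring.inverse_unit (u t)).symm
    rw [e]
    exact continuous_iff_continuousAt.2 fun t =>
      ContinuousAt.comp (f := fun t => X χ t x) (NormedRing.inverse_continuousAt (u t))
        hcU.continuousAt
  have hcomp : ∀ s t z, X χ t x (X χ (-s) (χ s x) z) = X χ (t - s) (χ s x) z := fun s t z => by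
    have := X_add hχ hB hc hinv t (-s) (hinv s x hx)
    rw [hback, ← sub_eq_add_neg] at this
    exact (DFunLike.congr_fun this z).symm
  have hP : ∀ s z, stableProj v Lm Lp x (X χ (-s) (χ s x) z) =
      X χ (-s) (χ s x) (stableProj v Lm Lp (χ s x) z) := fun s z => by
    have := h.stableProj_X hχ hB hc hinv (-s) (hinv s x hx) z
    rwa [hback] at this
  refine ⟨fun t => hasDerivAt_X hχ hB hc hinv t hx, X_zero x, left_inv, right_inv, hcV,
    fun t => hB.norm_fderiv_self_le (hinv t x hx),
    fun z => h.stableProj_of_mem hx (stableProj_mem _ _), hα, ?_, ?_⟩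
  · intro s t _ hst z
    rw [hP, hcomp]
    refine (h.bound_minus (t - s) (sub_nonneg.2 hst) _ (hinv s x hx) _
      (stableProj_mem _ _)).trans ?_
    have h1 : ‖stableProj v Lm Lp (χ s x) z‖ ≤ q' * ‖z‖ :=
      (hproj _ _).trans (hq' _ (hinv s x hx) z)
    calc _ ≤ c * Real.exp (-α * (t - s)) * (q' * ‖z‖) := by gcongr
      _ = c * (q' * Real.exp (-α * (t - s)) * ‖z‖) := by ring
      _ ≤ (c + b ^ 2) * (q' * Real.exp (-α * (t - s)) * ‖z‖) := by
        gcongr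
        linarith [sq_nonneg b]
      _ = _ := by ring
  · intro s t _ hts z
    have hy := hinv s x hx
    rw [hP, ← map_sub, hcomp, h.sub_stableProj hy, map_add, map_smul,
      X_apply_v hχ hB hc hinv _ hy]
    set u := Ring.inverse (frame v Lm Lp (χ s x)) z
    have hu : ‖u‖ ≤ q' * ‖z‖ := hq' _ hy z
    have h1 := h.bound_plus (t - s) (sub_nonpos.2 hts) _ hy _
      (Submodule.starProjection_apply_mem (Lp (χ s x)) u)
    have h2 : Real.exp (α * (t - s)) ≤ 1 :=
      Real.exp_le_one_iff.2 (mul_nonpos_of_nonneg_of_nonpos hα.le (sub_nonpos.2 hts))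
    have h3 : ‖⟪v (χ s x), u⟫ • v (χ (t - s) (χ s x))‖ ≤ b * ‖u‖ * b := by
      rw [norm_smul]
      have hb0 : 0 ≤ b := (norm_nonneg _).trans (hb _ hy)
      have := hb _ (hinv (t - s) _ hy)
      have := hb _ hy
      have := norm_inner_le_norm (𝕜 := ℝ) (v (χ s x)) u
      calc _ ≤ (‖v (χ s x)‖ * ‖u‖) * ‖v (χ (t - s) (χ s x))‖ := by gcongr
        _ ≤ _ := by gcongr
    calc _ ≤ _ := norm_add_le _ _
      _ ≤ c * 1 * ‖u‖ + b * ‖u‖ * b := by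
        refine add_le_add (h1.trans ?_) h3
        gcongr
        exact hproj _ _
      _ = (c + b ^ 2) * ‖u‖ := by ring
      _ ≤ (c + b ^ 2) * (q' * ‖z‖) := by gcongr
      _ = _ := by ring

end IsHyperbolicAlong

end AsymptoticPhase

/-! ### The weighted equation along a single orbit. -/

namespace AsymptoticPhase

open BoundedContinuousFunction
open scoped NNReal

section Weighted

variable {E : Type*} [NormedAddCommGroup E] [InnerProductSpace ℝ E]
  {v : E → E} {χ : Flow ℝ E} {M : Set E} {B α : ℝ} {ξ : E}

/-- The nonlinearity `w` in the weighted variable `u = e^{αt} y`. -/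
def weightedW (v : E → E) (χ : Flow ℝ E) (α : ℝ) (ξ : E) (t : ℝ≥0) (u : E) : E :=
  Real.exp (2 * α * t) • w v χ t (Real.exp (-α * t) • u) ξ

/-- The derivative of `weightedW` with respect to `u`. -/
def weightedW' (v : E → E) (χ : Flow ℝ E) (α : ℝ) (ξ : E) (t : ℝ≥0) (u : E) : E →L[ℝ] E :=
  Real.exp (α * t) • (fderiv ℝ v (χ t ξ + Real.exp (-α * t) • u) - fderiv ℝ v (χ t ξ))

/-- The second derivative of `weightedW` with respect to `u`. -/
def weightedW'' (v : E → E) (χ : Flow ℝ E) (α : ℝ) (ξ : E) (t : ℝ≥0) (u : E) :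
    E →L[ℝ] E →L[ℝ] E :=
  fderiv ℝ (fderiv ℝ v) (χ t ξ + Real.exp (-α * t) • u)

theorem weightedW_zero (t : ℝ≥0) : weightedW v χ α ξ t 0 = 0 := by
  simp [weightedW, w]

theorem weightedW'_zero (t : ℝ≥0) : weightedW' v χ α ξ t 0 = 0 := by
  simp [weightedW']

theorem hasFDerivAt_comp_weight {G : Type*} [NormedAddCommGroup G] [NormedSpace ℝ G]
    {f : E → G} (hf : Differentiable ℝ f) (a : ℝ) (x u : E) :
    HasFDerivAt (fun u => f (x + a • u)) (a • fderiv ℝ f (x + a • u)) u := by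
  have h1 : HasFDerivAt (fun u : E => x + a • u) (a • ContinuousLinearMap.id ℝ E) u :=
    ((hasFDerivAt_id u).const_smul a).const_add x
  have h2 := (hf (x + a • u)).hasFDerivAt.comp u h1
  rwa [ContinuousLinearMap.comp_smul, ContinuousLinearMap.comp_id] at h2

theorem hasFDerivAt_weightedW (hv : Differentiable ℝ v) (t : ℝ≥0) (u : E) :
    HasFDerivAt (weightedW v χ α ξ t) (weightedW' v χ α ξ t u) u := by
  have h1 := (hasFDerivAt_comp_weight hv (Real.exp (-α * t)) (χ t ξ) u).sub_const (v (χ t ξ))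
  have h2 : HasFDerivAt (fun u : E => fderiv ℝ v (χ t ξ) (Real.exp (-α * t) • u))
      (Real.exp (-α * t) • fderiv ℝ v (χ t ξ)) u := by
    simp only [map_smul]
    exact (fderiv ℝ v (χ t ξ)).hasFDerivAt.const_smul (Real.exp (-α * t))
  have h3 := (h1.sub h2).const_smul (Real.exp (2 * α * t))
  have e : weightedW' v χ α ξ t u = Real.exp (2 * α * t) •
      (Real.exp (-α * t) • fderiv ℝ v (χ t ξ + Real.exp (-α * t) • u) -
        Real.exp (-α * t) • fderiv ℝ v (χ t ξ)) := by
    rw [← smul_sub, smul_smul, ← Real.exp_add, weightedW']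
    ring_nf
  rw [e]
  exact h3

theorem hasFDerivAt_weightedW' (hv : Differentiable ℝ (fderiv ℝ v)) (t : ℝ≥0) (u : E) :
    HasFDerivAt (weightedW' v χ α ξ t) (weightedW'' v χ α ξ t u) u := by
  have h1 := ((hasFDerivAt_comp_weight hv (Real.exp (-α * t)) (χ t ξ) u).sub_const
    (fderiv ℝ v (χ t ξ))).const_smul (Real.exp (α * t))
  have e : weightedW'' v χ α ξ t u = Real.exp (α * t) •
      (Real.exp (-α * t) • fderiv ℝ (fderiv ℝ v) (χ t ξ + Real.exp (-α * t) • u)) := by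
    rw [smul_smul, ← Real.exp_add, neg_mul, add_neg_cancel, Real.exp_zero, one_smul, weightedW'',
      neg_mul]
  rw [e]
  exact h1

theorem norm_exp_neg_smul_le (hα : 0 ≤ α) (t : ℝ≥0) (u : E) :
    ‖Real.exp (-α * t) • u‖ ≤ ‖u‖ := by
  rw [norm_smul, Real.norm_of_nonneg (Real.exp_pos _).le]
  refine mul_le_of_le_one_left (norm_nonneg _) (Real.exp_le_one_iff.2 ?_)
  nlinarith [mul_nonneg hα t.2]

/-- The weight `e^{2αt}` exactly cancels the two factors `e^{-αt}` produced by the quadratic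
remainder. -/
theorem norm_weightedW_le (hB : TaylorBound v M B) (hα : 0 ≤ α)
    (hinv : ∀ t, ∀ x ∈ M, χ t x ∈ M) (hξ : ξ ∈ M) (t : ℝ≥0) {u : E} (hu : ‖u‖ ≤ 1) :
    ‖weightedW v χ α ξ t u‖ ≤ B * ‖u‖ ^ 2 := by
  have h1 := hB.norm_remainder_le (χ t ξ) (hinv t ξ hξ) (Real.exp (-α * t) • u)
    ((norm_exp_neg_smul_le hα t u).trans hu)
  rw [norm_smul (Real.exp _) u, Real.norm_of_nonneg (Real.exp_pos _).le] at h1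
  rw [weightedW, norm_smul, Real.norm_of_nonneg (Real.exp_pos _).le, w]
  calc _ ≤ Real.exp (2 * α * t) * (B * (Real.exp (-α * t) * ‖u‖) ^ 2) := by gcongr
    _ = Real.exp (2 * α * t) * (Real.exp (-α * t)) ^ 2 * (B * ‖u‖ ^ 2) := by ring
    _ = _ := by
      rw [← Real.exp_nat_mul, ← Real.exp_add]
      push_cast
      ring_nf
      simp

theorem norm_weightedW'_le (hB : TaylorBound v M B) (hα : 0 ≤ α)
    (hinv : ∀ t, ∀ x ∈ M, χ t x ∈ M) (hξ : ξ ∈ M) (t : ℝ≥0) {u : E} (hu : ‖u‖ ≤ 1) :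
    ‖weightedW' v χ α ξ t u‖ ≤ B * ‖u‖ := by
  have h1 := hB.norm_fderiv_sub_le (χ t ξ) (hinv t ξ hξ) (Real.exp (-α * t) • u)
    ((norm_exp_neg_smul_le hα t u).trans hu)
  rw [norm_smul (Real.exp _) u, Real.norm_of_nonneg (Real.exp_pos _).le] at h1
  rw [weightedW', norm_smul, Real.norm_of_nonneg (Real.exp_pos _).le]
  calc _ ≤ Real.exp (α * t) * (B * (Real.exp (-α * t) * ‖u‖)) := by gcongr
    _ = Real.exp (α * t) * Real.exp (-α * t) * (B * ‖u‖) := by ring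
    _ = _ := by rw [← Real.exp_add]; simp

variable [FiniteDimensional ℝ E]

/-- In the second derivative all weights cancel outside the argument, which stays in the compact set
`M` plus a ball; there `v''` is bounded and uniformly continuous. -/
theorem uniformOnBalls_weightedW'' (hv : ContDiff ℝ 2 v) (hM : IsCompact M) (hα : 0 ≤ α)
    (hinv : ∀ t, ∀ x ∈ M, χ t x ∈ M) (hξ : ξ ∈ M) :
    UniformOnBalls (weightedW'' v χ α ξ) := by
  have hc : Continuous (fderiv ℝ (fderiv ℝ v)) :=
    (hv.fderiv_right (m := 1) (by norm_num)).continuous_fderiv (by norm_num)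
  refine ⟨?_, fun R => ?_, fun R ε hε => ?_⟩
  · unfold weightedW''
    fun_prop
  · obtain ⟨C, hC⟩ := exists_norm_le_of_isCompact (G := E →L[ℝ] E →L[ℝ] E) hc hM R
    exact ⟨C, fun t u hu =>
      hC _ (hinv t ξ hξ) _ ((norm_exp_neg_smul_le hα t u).trans hu)⟩
  · obtain ⟨δ, hδ, h⟩ :=
      exists_uniform_of_isCompact (G := E →L[ℝ] E →L[ℝ] E) hc hM R ε hε
    refine ⟨δ, hδ, fun t u u' hu hu' huu => h _ (hinv t ξ hξ) _ _
      ((norm_exp_neg_smul_le hα t u).trans hu) ((norm_exp_neg_smul_le hα t u').trans hu') ?_⟩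
    rw [← smul_sub]
    exact (norm_exp_neg_smul_le hα t _).trans_lt huu

theorem uniformOnBalls_weightedW' (hv : ContDiff ℝ 2 v) (hM : IsCompact M) (hα : 0 ≤ α)
    (hinv : ∀ t, ∀ x ∈ M, χ t x ∈ M) (hξ : ξ ∈ M) :
    UniformOnBalls (weightedW' v χ α ξ) := by
  have hv1 : ContDiff ℝ 1 (fderiv ℝ v) := hv.fderiv_right (by norm_num)
  have hc := hv1.continuous
  refine (uniformOnBalls_weightedW'' hv hM hα hinv hξ).of_hasFDerivAt ?_ weightedW'_zero
    (hasFDerivAt_weightedW' (hv1.differentiable (by norm_num)))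
  unfold weightedW'
  fun_prop

theorem uniformOnBalls_weightedW (hv : ContDiff ℝ 2 v) (hM : IsCompact M) (hα : 0 ≤ α)
    (hinv : ∀ t, ∀ x ∈ M, χ t x ∈ M) (hξ : ξ ∈ M) :
    UniformOnBalls (weightedW v χ α ξ) := by
  have hv1 : ContDiff ℝ 1 (fderiv ℝ v) := hv.fderiv_right (by norm_num)
  have hc := hv1.continuous
  have hc0 := hv.continuous
  refine (uniformOnBalls_weightedW' hv hM hα hinv hξ).of_hasFDerivAt ?_ weightedW_zero
    (hasFDerivAt_weightedW (hv.differentiable (by norm_num)))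
  unfold weightedW w
  fun_prop

end Weighted

section Dichotomy

variable {E : Type*} [NormedAddCommGroup E] [NormedSpace ℝ E]
  {A U V : ℝ → E →L[ℝ] E} {P : E →L[ℝ] E} {B K α : ℝ}

theorem Dichotomy.norm_exp_smul_le (h : Dichotomy A U V P B K α) (η : E) (t : ℝ≥0) :
    ‖Real.exp (α * t) • U t (P η)‖ ≤ K * ‖η‖ := by
  have h1 := h.stable 0 t le_rfl t.2 η
  have h2 := h.left_inv 0 η
  rw [h.apply_zero, ContinuousLinearMap.id_apply] at h2
  rw [h2, sub_zero] at h1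
  rw [norm_smul, Real.norm_of_nonneg (Real.exp_pos _).le]
  calc _ ≤ Real.exp (α * t) * (K * Real.exp (-α * t) * ‖η‖) := by gcongr
    _ = Real.exp (α * t) * Real.exp (-α * t) * (K * ‖η‖) := by ring
    _ = _ := by rw [← Real.exp_add]; simp

/-- The solutions of the linear equation starting in the range of `P`, in the weighted variable
`u = e^{αt} y`. -/
def Dichotomy.homogeneous (h : Dichotomy A U V P B K α) (hK : 0 ≤ K) : E →L[ℝ] (ℝ≥0 →ᵇ E) :=
  LinearMap.mkContinuous
    { toFun := fun η => BoundedContinuousFunction.ofNormedAddCommGroup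
        (fun t : ℝ≥0 => Real.exp (α * t) • U t (P η))
        (by have := h.continuous; fun_prop) (K * ‖η‖) (h.norm_exp_smul_le η)
      map_add' := fun η η' => by ext t; simp
      map_smul' := fun a η => by ext t; simp [smul_comm a] }
    K fun η => (BoundedContinuousFunction.norm_le (mul_nonneg hK (norm_nonneg η))).2
      (h.norm_exp_smul_le η)

@[simp]
theorem Dichotomy.homogeneous_apply (h : Dichotomy A U V P B K α) (hK : 0 ≤ K) (η : E)
    (t : ℝ≥0) : h.homogeneous hK η t = Real.exp (α * t) • U t (P η) := rfl

theorem Dichotomy.norm_homogeneous_le (h : Dichotomy A U V P B K α) (hK : 0 ≤ K) (η : E) :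
    ‖h.homogeneous hK η‖ ≤ K * ‖η‖ :=
  (h.homogeneous hK).le_of_opNorm_le (LinearMap.mkContinuous_norm_le _ hK _) η

end Dichotomy

/-- Existence, uniqueness, smoothness and quadratic closeness to the linear flow of the solutions
decaying to the orbit of a given point `ξ`. -/
theorem exists_decaying_solutions {E : Type*} [NormedAddCommGroup E] [InnerProductSpace ℝ E]
    [FiniteDimensional ℝ E] {v : E → E} {χ : Flow ℝ E} {M : Set E} {B K α R r : ℝ} {ξ : E}
    {P : E →L[ℝ] E} {U V : ℝ → E →L[ℝ] E} (hv : ContDiff ℝ 2 v) (hM : IsCompact M)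
    (hinv : ∀ t, ∀ x ∈ M, χ t x ∈ M) (hB : TaylorBound v M B) (hξ : ξ ∈ M) (hK : 0 < K)
    (h : Dichotomy (fun t => fderiv ℝ v (χ t ξ)) U V P B K α) (hR : 0 < R) (hR1 : R ≤ 1)
    (hsmall : 2 * K / α * (B * R) ≤ 1 / 2) (hr : K * r ≤ R / 2) :
    ∃ y : ℝ → E → E,
      (∀ η, P η = η → ‖η‖ < r →
        IsSolution v χ ξ (fun t => y t η) ∧
        (∀ t, 0 ≤ t → ‖y t η‖ ≤ R * Real.exp (-α * t)) ∧ P (y 0 η) = η ∧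
        (∀ z : ℝ → E, IsSolution v χ ξ z → (∀ t, 0 ≤ t → ‖z t‖ ≤ R * Real.exp (-α * t)) →
          P (z 0) = η → ∀ t, 0 ≤ t → z t = y t η) ∧
        ∀ t, 0 ≤ t → ‖y t η - U t η‖ ≤
          2 * K / α * (B * (2 * K) ^ 2) * Real.exp (-α * t) * ‖η‖ ^ 2) ∧
      ∀ t, 0 ≤ t → ContDiffOn ℝ 2 (y t) (Metric.ball 0 r) := by
  have hα := h.alpha_pos
  have hBp := hB.pos
  have hd2 : Differentiable ℝ (fderiv ℝ v) :=
    (hv.fderiv_right (m := 1) (by norm_num)).differentiable (by norm_num)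
  have hF := uniformOnBalls_weightedW hv hM hα.le hinv hξ
  have hF' := uniformOnBalls_weightedW' hv hM hα.le hinv hξ
  have hF'' := uniformOnBalls_weightedW'' hv hM hα.le hinv hξ
  have hdF := hasFDerivAt_weightedW (χ := χ) (α := α) (ξ := ξ) hB.differentiable
  have hΨ : ContDiff ℝ 2 fun u => h.green hK.le (nemytskii _ hF u) :=
    (h.green hK.le).contDiff.comp
      (contDiff_two_nemytskii hF hF' hF'' hdF (hasFDerivAt_weightedW' hd2))
  have hΨ0 : h.green hK.le (nemytskii _ hF 0) = 0 := by
    have : nemytskii _ hF 0 = 0 := by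
      ext t
      simp [weightedW_zero]
    rw [this, map_zero]
  have hN : ∀ u : ℝ≥0 →ᵇ E, ‖u‖ ≤ 1 → ‖nemytskii _ hF u‖ ≤ B * ‖u‖ ^ 2 := fun u hu =>
    (BoundedContinuousFunction.norm_le (by positivity)).2 fun t => by
      have h1 := u.norm_coe_le_norm t
      refine (norm_weightedW_le hB hα.le hinv hξ t (h1.trans hu)).trans ?_
      gcongr
  have hΨ' : ∀ u ∈ Metric.closedBall (0 : ℝ≥0 →ᵇ E) R,
      ‖fderiv ℝ (fun u => h.green hK.le (nemytskii _ hF u)) u‖ ≤ 1 / 2 := by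
    intro u hu
    rw [mem_closedBall_zero_iff] at hu
    have h1 := (h.green hK.le).hasFDerivAt.comp u (hasFDerivAt_nemytskii hF hF' hdF u)
    have h2 : ‖nemytskii _ hF' u‖ ≤ B * R :=
      (BoundedContinuousFunction.norm_le (by positivity)).2 fun t => by
        have h3 := (u.norm_coe_le_norm t).trans hu
        refine (norm_weightedW'_le hB hα.le hinv hξ t (h3.trans hR1)).trans ?_
        gcongr
    have h4 : fderiv ℝ (fun u => h.green hK.le (nemytskii _ hF u)) u =
        (h.green hK.le) ∘L (applyL ℝ≥0 E E (nemytskii _ hF' u)) := h1.fderiv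
    rw [h4]
    calc _ ≤ ‖h.green hK.le‖ * ‖applyL ℝ≥0 E E (nemytskii _ hF' u)‖ :=
          ContinuousLinearMap.opNorm_comp_le _ _
      _ ≤ 2 * K / α * (B * R) := mul_le_mul (h.norm_green_le hK.le)
          ((norm_applyL_le _).trans h2) (by positivity) (by positivity)
      _ ≤ 1 / 2 := hsmall
  obtain ⟨S, hS, hSd⟩ := exists_contDiffOn_solution hΨ hΨ0 hR hΨ'
  have hmem : ∀ η, ‖η‖ < r → h.homogeneous hK.le η ∈ Metric.ball (0 : ℝ≥0 →ᵇ E) (R / 2) := by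
    intro η hη
    rw [mem_ball_zero_iff]
    refine (h.norm_homogeneous_le hK.le η).trans_lt (lt_of_lt_of_le ?_ hr)
    gcongr
  have hexp : ∀ t : ℝ, Real.exp (-α * t) * Real.exp (α * t) = 1 := fun t => by
    rw [← Real.exp_add]; simp
  have hexp2 : ∀ t : ℝ, Real.exp (-2 * α * t) * Real.exp (2 * α * t) = 1 := fun t => by
    rw [← Real.exp_add]; simp
  refine ⟨fun t η => Real.exp (-α * t) • S (h.homogeneous hK.le η) t.toNNReal,
    fun η hη hηr => ?_, fun t ht => ?_⟩
  swap
  · have h1 : ContDiffOn ℝ 2 (fun η => S (h.homogeneous hK.le η)) (Metric.ball 0 r) :=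
      -- The free term is linear in `η`, and evaluation at a fixed time is linear in the solution,
      -- so all smoothness comes from `S`.
      hSd.comp (h.homogeneous hK.le).contDiff.contDiffOn fun η hη => hmem η (by simpa using hη)
    let ev : (ℝ≥0 →ᵇ E) →L[ℝ] E := BoundedContinuousFunction.evalCLM ℝ t.toNNReal
    have h2 : ContDiffOn ℝ 2 (fun η => S (h.homogeneous hK.le η) t.toNNReal)
        (Metric.ball 0 r) :=
      ev.contDiff.comp_contDiffOn h1
    exact h2.const_smul (Real.exp (-α * t))
  obtain ⟨hSe, hSn, hSu⟩ := hS _ (hmem η hηr)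
  set u := S (h.homogeneous hK.le η)
  have hu : ‖u‖ ≤ 2 * K * ‖η‖ := by
    have := h.norm_homogeneous_le hK.le η
    linarith
  have huR : ‖u‖ ≤ R := by
    have := mem_ball_zero_iff.1 (hmem η hηr)
    linarith
  -- With the weight removed, the fixed point equation is the variation of constants formula.
  have hrepr : ∀ t : ℝ, 0 ≤ t → Real.exp (-α * t) • u t.toNNReal =
      U t η + Dichotomy.decaying U V P α (nemytskii _ hF u) t := by
    intro t ht
    rw [DFunLike.congr_fun hSe t.toNNReal, BoundedContinuousFunction.add_apply,
      h.homogeneous_apply, h.green_apply, hη, Real.coe_toNNReal t ht, ← smul_add, smul_smul, hexp, one_smul]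
  have hforce : ∀ t : ℝ, 0 ≤ t → Real.exp (-2 * α * t) • nemytskii _ hF u t.toNNReal =
      w v χ t (Real.exp (-α * t) • u t.toNNReal) ξ := by
    intro t ht
    rw [nemytskii_apply, weightedW, Real.coe_toNNReal t ht, smul_smul, hexp2, one_smul]
  refine ⟨fun t ht => ?_, fun t ht => ?_, ?_, fun z hz hzR hzη t ht => ?_, fun t ht => ?_⟩
  · have h1 := (h.hasDerivAt_add_decaying (nemytskii _ hF u) η t).hasDerivWithinAt (s := Ici 0)
    rw [hforce t ht, ← hrepr t ht] at h1
    exact h1.congr (fun s hs => hrepr s hs) (hrepr t ht)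
  · rw [norm_smul, Real.norm_of_nonneg (Real.exp_pos _).le, mul_comm]
    gcongr
    exact (u.norm_coe_le_norm _).trans huR
  · show P (Real.exp (-α * 0) • u (Real.toNNReal 0)) = η
    rw [hrepr 0 le_rfl, Dichotomy.decaying, h.apply_zero]
    simp [hη, h.proj_defect hK.le]
  -- The decay hypothesis on the competitor `z` says precisely that its weighted form lies in the
  -- closed ball of radius `R`, where the fixed point is unique.
  · let u' : ℝ≥0 →ᵇ E := BoundedContinuousFunction.ofNormedAddCommGroup
      (fun t : ℝ≥0 => Real.exp (α * t) • z t)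
      (by
        have hzc : ContinuousOn z (Ici 0) := fun t ht => (hz t ht).continuousWithinAt
        have : Continuous fun t : ℝ≥0 => z t :=
          hzc.comp_continuous NNReal.continuous_coe fun t => t.2
        exact (by fun_prop : Continuous fun t : ℝ≥0 => Real.exp (α * t)).smul this) R
      fun t => by
        rw [norm_smul, Real.norm_of_nonneg (Real.exp_pos _).le]
        calc _ ≤ Real.exp (α * t) * (R * Real.exp (-α * t)) := by
              gcongr
              exact hzR t t.2
          _ = R * (Real.exp (-α * t) * Real.exp (α * t)) := by ring
          _ = R := by rw [hexp, mul_one]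
    have hzu : ∀ t : ℝ, 0 ≤ t → Real.exp (-α * t) • u' t.toNNReal = z t := by
      intro t ht
      show Real.exp (-α * t) • (Real.exp (α * t.toNNReal) • z t.toNNReal) = z t
      rw [Real.coe_toNNReal t ht, smul_smul, hexp, one_smul]
    have hu'R : ‖u'‖ ≤ R := BoundedContinuousFunction.norm_ofNormedAddCommGroup_le _ hR.le _
    have hforce' : ∀ t : ℝ, 0 ≤ t → w v χ t (z t) ξ =
        Real.exp (-2 * α * t) • nemytskii _ hF u' t.toNNReal := by
      intro t ht
      rw [nemytskii_apply, weightedW, Real.coe_toNNReal t ht, smul_smul, hexp2, one_smul,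
        hzu t ht]
    have heq : ∀ t, 0 ≤ t →
        z t = U t η + Dichotomy.decaying U V P α (nemytskii _ hF u') t := by
      intro t ht
      rw [← hzη]
      refine h.eq_add_decaying hK.le (nemytskii _ hF u') (fun s hs => ?_) hzR ht
      rw [← hforce' s hs]
      exact hz s hs
    have hfix : u' = h.homogeneous hK.le η + h.green hK.le (nemytskii _ hF u') := by
      ext t
      show Real.exp (α * t) • z t = _
      rw [BoundedContinuousFunction.add_apply, h.homogeneous_apply, h.green_apply, hη,
        ← smul_add, ← heq t t.2]
    rw [← hzu t ht, hSu u' (mem_closedBall_zero_iff.2 hu'R) hfix]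
  · show ‖Real.exp (-α * t) • u t.toNNReal - U t η‖ ≤ _
    rw [hrepr t ht, add_sub_cancel_left]
    calc _ ≤ 2 * K / α * ‖nemytskii _ hF u‖ * Real.exp (-α * t) := h.norm_decaying_le hK.le _ ht
      _ ≤ 2 * K / α * (B * (2 * K * ‖η‖) ^ 2) * Real.exp (-α * t) := by
        gcongr
        refine (hN u (huR.trans hR1)).trans ?_
        gcongr
      _ = _ := by ring

end AsymptoticPhase

/-! ### Reduction to the flow and continuity in the base point. -/

namespace AsymptoticPhase

section Solutions

variable {E : Type*} [NormedAddCommGroup E] [InnerProductSpace ℝ E]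
  {v : E → E} {χ : Flow ℝ E} {ξ : E}

theorem fderiv_add_w (t : ℝ) (y : E) :
    fderiv ℝ v (χ t ξ) y + w v χ t y ξ = v (χ t ξ + y) - v (χ t ξ) := by
  rw [w]; abel

/-- Differences of two trajectories solve the equation of perturbed motion. -/
theorem isSolution_flow_sub (hχ : Generates v χ) (a : E) :
    IsSolution v χ ξ fun t => χ t (ξ + a) - χ t ξ := by
  intro t _
  rw [fderiv_add_w, add_sub_cancel]
  exact ((hχ (ξ + a) t).sub (hχ ξ t)).hasDerivWithinAt

/-- Every solution of the equation of perturbed motion is a difference of two trajectories. -/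
theorem IsSolution.eq_flow_sub [FiniteDimensional ℝ E] {y : ℝ → E} (hy : IsSolution v χ ξ y)
    (hv : ContDiff ℝ 1 v) (hχ : Generates v χ) {T : ℝ} (hT : 0 ≤ T) :
    y T = χ T (ξ + y 0) - χ T ξ := by
  have hyc : ContinuousOn (fun t => χ t ξ + y t) (Icc 0 T) :=
    (Continuous.continuousOn (by fun_prop)).add
      fun t ht => ((hy t ht.1).continuousWithinAt).mono Icc_subset_Ici_self
  have hzc : ContinuousOn (fun t => χ t (ξ + y 0)) (Icc 0 T) :=
    Continuous.continuousOn (by fun_prop)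
  obtain ⟨ρ₁, h₁⟩ := isCompact_Icc.exists_bound_of_continuousOn hyc
  obtain ⟨ρ₂, h₂⟩ := isCompact_Icc.exists_bound_of_continuousOn hzc
  -- `v` is only locally Lipschitz, so uniqueness is applied in a ball containing both curves over
  -- `[0, T]`.
  obtain ⟨L, hL⟩ := (isCompact_closedBall (0 : E) (max ρ₁ ρ₂)).exists_bound_of_continuousOn
    (hv.continuous_fderiv (by norm_num)).continuousOn
  have hlip : LipschitzOnWith L.toNNReal v (Metric.closedBall 0 (max ρ₁ ρ₂)) :=
    (convex_closedBall _ _).lipschitzOnWith_of_nnnorm_fderiv_le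
      (fun x _ => hv.differentiable (by norm_num) x)
      fun x hx => NNReal.coe_le_coe.1 ((hL x hx).trans (Real.le_coe_toNNReal L))
  have := ODE_solution_unique_of_mem_Icc_right (v := fun _ => v) (K := L.toNNReal)
    (s := fun _ => Metric.closedBall 0 (max ρ₁ ρ₂)) (a := 0) (b := T) (fun _ _ => hlip) hyc
    (fun t ht => by
      have h3 := ((hχ ξ t).hasDerivWithinAt (s := Ici t)).add
        ((hy t ht.1).mono (Ici_subset_Ici.2 ht.1))
      rw [fderiv_add_w, add_sub_cancel] at h3
      exact h3)
    (fun t ht => by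
      simpa using (h₁ t (Ico_subset_Icc_self ht)).trans (le_max_left _ _)) hzc
    (fun t _ => (hχ (ξ + y 0) t).hasDerivWithinAt)
    (fun t ht => by
      simpa using (h₂ t (Ico_subset_Icc_self ht)).trans (le_max_right _ _))
    (by simp) ⟨hT, le_rfl⟩
  exact eq_sub_of_add_eq' this

end Solutions

/-- Decaying solutions which are determined by their stable component at time `0` depend
continuously on it and on the base point. -/
theorem continuousOn_initial_value {E : Type*} [NormedAddCommGroup E] [InnerProductSpace ℝ E]
    [FiniteDimensional ℝ E] {χ : Flow ℝ E} {M : Set E} {Lm : E → Submodule ℝ E}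
    {P : E → E →L[ℝ] E} (hP : ContinuousOn P M) {R r α : ℝ} {g : E × E → E}
    (hg : ∀ q ∈ N M Lm r, P q.1 (g q) = q.2)
    (hgR : ∀ q ∈ N M Lm r, ∀ t : ℝ, 0 ≤ t →
      ‖χ t (q.1 + g q) - χ t q.1‖ ≤ R * Real.exp (-α * t))
    (huniq : ∀ q ∈ N M Lm r, ∀ a, P q.1 a = q.2 →
      (∀ t : ℝ, 0 ≤ t → ‖χ t (q.1 + a) - χ t q.1‖ ≤ R * Real.exp (-α * t)) → a = g q) :
    ContinuousOn g (N M Lm r) := by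
  intro q hq
  -- The decay bound at `t = 0` confines `g` to a compact ball. For a cluster point `a`, the
  -- projection condition and the bound at each fixed `t` pass to the limit, so `huniq` identifies
  -- `a`.
  refine (isCompact_closedBall (0 : E) R).tendsto_nhds_of_unique_mapClusterPt ?_ fun a _ ha => ?_
  · filter_upwards [self_mem_nhdsWithin] with p hp
    simpa using hgR p hp 0 le_rfl
  obtain ⟨l, hl, hla⟩ := mapClusterPt_iff_ultrafilter.1 ha
  have hlN : ∀ᶠ p in (l : Filter (E × E)), p ∈ N M Lm r := hl self_mem_nhdsWithin
  have hlq : Tendsto id (l : Filter (E × E)) (𝓝 q) := hl.trans nhdsWithin_le_nhds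
  have h1 : Tendsto (fun p : E × E => p.1) l (𝓝 q.1) := continuous_fst.continuousAt.tendsto.comp hlq
  have h2 : Tendsto (fun p : E × E => p.2) l (𝓝 q.2) := continuous_snd.continuousAt.tendsto.comp hlq
  have h1M : Tendsto (fun p : E × E => p.1) l (𝓝[M] q.1) :=
    tendsto_nhdsWithin_iff.2 ⟨h1, hlN.mono fun p hp => hp.1⟩
  have h3 : Tendsto (fun p : E × E => P p.1) l (𝓝 (P q.1)) := (hP q.1 hq.1).tendsto.comp h1M
  refine huniq q hq a ?_ fun t ht => ?_
  · have h4 : Tendsto (fun p : E × E => P p.1 (g p)) l (𝓝 (P q.1 a)) :=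
      (isBoundedBilinearMap_apply.continuous.tendsto (P q.1, a)).comp (h3.prodMk_nhds hla)
    refine tendsto_nhds_unique h4 (h2.congr' ?_)
    filter_upwards [hlN] with p hp using (hg p hp).symm
  · have hcont : Continuous fun p : E × E => ‖χ t (p.1 + p.2) - χ t p.1‖ := by fun_prop
    have h4 : Tendsto (fun p => ‖χ t (p.1 + g p) - χ t p.1‖) l
        (𝓝 ‖χ t (q.1 + a) - χ t q.1‖) :=
      (hcont.tendsto (q.1, a)).comp (h1.prodMk_nhds hla)
    exact le_of_tendsto h4 (hlN.mono fun p hp => hgR p hp t ht)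

end AsymptoticPhase

end

/-! ### Choice of the radii and assembly. -/

theorem proposition1 {E : Type*} [NormedAddCommGroup E] [InnerProductSpace ℝ E]
    [FiniteDimensional ℝ E] (v : E → E) (hv : ContDiff ℝ 2 v) (χ : Flow ℝ E)
    (hχ : AsymptoticPhase.Generates v χ) (m : ℕ) (M D : Set E)
    (hM : AsymptoticPhase.IsAttractingManifold χ m M D) (Lm Lp : E → Submodule ℝ E) (c α : ℝ)
    (hyp : AsymptoticPhase.IsHyperbolicAlong v χ M Lm Lp c α) :
    ∃ r ∈ Ioo (0 : ℝ) 1, ∃ R ∈ Ioo (0 : ℝ) 1, ∃ ystar : ℝ → E → E → E,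
      -- (i) existence and uniqueness
      (∀ (ξ : E) (hξ : ξ ∈ M), ∀ η ∈ Lm ξ, ‖η‖ < r →
        (AsymptoticPhase.IsSolution v χ ξ (fun t => ystar t ξ η) ∧
          (∀ t : ℝ, 0 ≤ t → ‖ystar t ξ η‖ ≤ R * Real.exp (-α * t)) ∧
          hyp.projMinus hξ (ystar 0 ξ η) = η) ∧
        ∀ y : ℝ → E, AsymptoticPhase.IsSolution v χ ξ y →
          (∀ t : ℝ, 0 ≤ t → ‖y t‖ ≤ R * Real.exp (-α * t)) →
          hyp.projMinus hξ (y 0) = η →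
          EqOn y (fun t => ystar t ξ η) (Ici 0)) ∧
      -- (ii) joint continuity, and `C²` dependence on `η`
      ContinuousOn (fun q : ℝ × E × E => ystar q.1 q.2.1 q.2.2)
        (Ici (0 : ℝ) ×ˢ AsymptoticPhase.N M Lm r) ∧
      (∀ t : ℝ, 0 ≤ t → ∀ ξ ∈ M,
        ContDiffOn ℝ 2 (fun η : Lm ξ => ystar t ξ (η : E)) (Metric.ball 0 r)) ∧
      -- (iii) quadratic closeness to the linear flow
      ∃ C₀ : ℝ, 0 < C₀ ∧ ∀ t : ℝ, 0 ≤ t → ∀ p ∈ AsymptoticPhase.N M Lm r,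
        ‖ystar t p.1 p.2 - AsymptoticPhase.X χ t p.1 p.2‖
          ≤ C₀ * Real.exp (-α * t) * ‖p.2‖ ^ 2 := by
  have hinv : ∀ t, ∀ x ∈ M, χ t x ∈ M := fun t x hx => by
    rw [← hM.invariant t]
    exact mem_image_of_mem _ hx
  have hα := hyp.alpha_pos
  obtain ⟨B, hB⟩ := AsymptoticPhase.exists_taylorBound hv hM.isCompact
  have hBp := hB.pos
  obtain ⟨K, hK, hdich⟩ := hyp.exists_dichotomy hχ hM.isCompact hB
    (hv.continuous_fderiv (by norm_num)) hinv
  -- `2K/α` bounds the Green operator and `B * R` the derivative of the nonlinearity on the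
  -- `R`-ball, so the contraction constant is `1/2`.
  obtain ⟨R, hR, hR1, hRK⟩ : ∃ R : ℝ, 0 < R ∧ R < 1 ∧ 2 * K / α * (B * R) ≤ 1 / 2 := by
    refine ⟨min (1 / 2) (α / (4 * K * B)), by positivity,
      (min_le_left _ _).trans_lt (by norm_num), ?_⟩
    calc _ ≤ 2 * K / α * (B * (α / (4 * K * B))) := by
          gcongr
          exact min_le_right _ _
      _ = 1 / 2 := by field_simp; norm_num
  -- This keeps the free term in the ball of radius `R / 2` on which the fixed point equation is
  -- solved.
  obtain ⟨r, hr, hr1, hrK⟩ : ∃ r : ℝ, 0 < r ∧ r < 1 ∧ K * r ≤ R / 2 := by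
    refine ⟨min (1 / 2) (R / (2 * K)), by positivity,
      (min_le_left _ _).trans_lt (by norm_num), ?_⟩
    calc _ ≤ K * (R / (2 * K)) := by
          gcongr
          exact min_le_right _ _
      _ = R / 2 := by field_simp
  have hex := fun ξ (hξ : ξ ∈ M) => AsymptoticPhase.exists_decaying_solutions hv hM.isCompact
    hinv hB hξ hK (hdich ξ hξ) hR hR1.le hRK hrK
  choose! y hy hyd using hex
  have hfix : ∀ ξ ∈ M, ∀ η ∈ Lm ξ,
      AsymptoticPhase.IsHyperbolicAlong.stableProj v Lm Lp ξ η = η :=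
    fun ξ hξ η hη => hyp.stableProj_of_mem hξ hη
  have hflow : ∀ q ∈ AsymptoticPhase.N M Lm r, ∀ t, 0 ≤ t →
      y q.1 t q.2 = χ t (q.1 + y q.1 0 q.2) - χ t q.1 := fun q hq t ht =>
    (hy q.1 hq.1 q.2 (hfix _ hq.1 _ hq.2.1) hq.2.2).1.eq_flow_sub (hv.of_le (by norm_num)) hχ ht
  have hcont0 : ContinuousOn (fun q : E × E => y q.1 0 q.2) (AsymptoticPhase.N M Lm r) := by
    refine AsymptoticPhase.continuousOn_initial_value (χ := χ) (R := R) (α := α)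
      (hyp.continuousOn_stableProj hv.continuous) (fun q hq => ?_) (fun q hq t ht => ?_)
      fun q hq a ha haR => ?_
    · exact (hy q.1 hq.1 q.2 (hfix _ hq.1 _ hq.2.1) hq.2.2).2.2.1
    · rw [← hflow q hq t ht]
      exact (hy q.1 hq.1 q.2 (hfix _ hq.1 _ hq.2.1) hq.2.2).2.1 t ht
    · have := (hy q.1 hq.1 q.2 (hfix _ hq.1 _ hq.2.1) hq.2.2).2.2.2.1 _
        (AsymptoticPhase.isSolution_flow_sub hχ a) haR (by simpa using ha) 0 le_rfl
      simpa using this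
  refine ⟨r, ⟨hr, hr1⟩, R, ⟨hR, hR1⟩, fun t ξ η => y ξ t η, fun ξ hξ η hη hηr => ?_, ?_,
    fun t ht ξ hξ => ?_, 2 * K / α * (B * (2 * K) ^ 2), by positivity, fun t ht p hp => ?_⟩
  · obtain ⟨h1, h2, h3, h4, -⟩ := hy ξ hξ η (hfix ξ hξ η hη) hηr
    refine ⟨⟨h1, h2, by rw [hyp.projMinus_eq hξ]; exact h3⟩, fun z hz hzR hzη t ht => ?_⟩
    exact h4 z hz hzR (by rw [← hyp.projMinus_eq hξ]; exact hzη) t ht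
  · have h1 : ContinuousOn (fun q : ℝ × E × E => y q.2.1 0 q.2.2)
        (Ici (0 : ℝ) ×ˢ AsymptoticPhase.N M Lm r) :=
      hcont0.comp continuous_snd.continuousOn fun q hq => hq.2
    have h2 : ContinuousOn (fun q : ℝ × E × E => (q.1, q.2.1 + y q.2.1 0 q.2.2))
        (Ici (0 : ℝ) ×ˢ AsymptoticPhase.N M Lm r) :=
      continuous_fst.continuousOn.prodMk ((Continuous.continuousOn (by fun_prop)).add h1)
    have h3 : Continuous fun q : ℝ × E => χ q.1 q.2 := by fun_prop
    have h4 : Continuous fun q : ℝ × E × E => χ q.1 q.2.1 := by fun_prop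
    exact ((h3.comp_continuousOn h2).sub h4.continuousOn).congr
      fun q hq => hflow q.2 hq.2 q.1 hq.1
  · exact (hyd ξ hξ t ht).comp (Lm ξ).subtypeL.contDiff.contDiffOn fun η hη => by simpa using hη
  · exact (hy p.1 hp.1 p.2 (hfix _ hp.1 _ hp.2.1) hp.2.2).2.2.2.2 t ht
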